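/- Let $M$ be a connected noncompact smooth manifold (Hausdorff, second countable, without boundary) of dimension $n$. (1) Let $A$ be a second-order locally uniformly elliptic linear differential operator on $M$ with locally bounded coefficients; that is, in every system of local coordinates $(x_1,\dots,x_n)$ of the smooth structure, $$A=\sum_{i,j=1}^n a_{ij}\frac{\partial^2}{\partial x_i\partial x_j}+\sum_{i=1}^n b_i\frac{\partial}{\partial x_i}+c$$ on functions of class $C^2$, where $a_{ij}$, $b_i$ and $c$ are locally bounded real-valued functions (no continuity or measurability is required) and $(a_{ij})$ is symmetric with eigenvalues locally bounded below by a positive constant. Let $\rho$ be a positive continuous function on $M$. Then there is a $C^\infty$ function $\varphi:M\to\mathbb R$ such that $\varphi>\rho$ and $A\varphi>\rho$ everywhere on $M$. (2) For every smooth Riemannian metric $g$ on $M$ there is a $C^\infty$ function $\varphi:M\to\mathbb R$ which is - strictly subharmonic, i.e. $\Delta_g\varphi>0$ everywhere, where in local coordinates $$\Delta_g\varphi=\frac1{\sqrt G}\sum_{i,j=1}^n\frac{\partial}{\partial x_i}\Bigl[g^{ij}\sqrt G\,\frac{\partial\varphi}{\partial x_j}\Bigr],\qquad G=\det(g_{ij}),\quad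 (g^{ij})=(g_{ij})^{-1};$$ - an exhaustion function, i.e. $\{x\in M:\varphi(x)<a\}$ is relatively compact in $M$ for every $a\in\mathbb R$. -/

import Mathlib

open scoped Manifold ContDiff Topology

noncomputable section

namespace EllipticExhaustion

/-- The `i`-th partial derivative of a real-valued function on `ℝⁿ`. -/
def pderiv {n : ℕ} (i : Fin n) (f : EuclideanSpace ℝ (Fin n) → ℝ)
    (y : EuclideanSpace ℝ (Fin n)) : ℝ :=
  fderiv ℝ f y (EuclideanSpace.single i 1)

section

variable {n : ℕ} {M : Type*} [TopologicalSpace M]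
  [ChartedSpace (EuclideanSpace ℝ (Fin n)) M]

/-- A real-valued function is locally bounded on `U`. Only the values near points of `U` matter. -/
def LocallyBoundedOn {X : Type*} [TopologicalSpace X] (f : X → ℝ) (U : Set X) : Prop :=
  ∀ p ∈ U, ∃ C : ℝ, ∀ᶠ x in 𝓝[U] p, |f x| ≤ C

/-- `A` is a second order, locally uniformly elliptic linear differential operator with locally
bounded coefficients on `M`, acting on real-valued functions of class `C²`: in every local
coordinate system `e` of the smooth structure it has the form
`∑ aᵢⱼ ∂²/∂xᵢ∂xⱼ + ∑ bᵢ ∂/∂xᵢ + c`, where `aᵢⱼ`, `bᵢ`, `c` are locally bounded real-valued functions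
on the coordinate domain and `(aᵢⱼ)` is symmetric with eigenvalues locally bounded below by a
positive constant. (The values of `A` on functions that are not `C²` are irrelevant.) -/
def IsLocallyUniformlyElliptic (A : (M → ℝ) → (M → ℝ)) : Prop :=
  ∀ e ∈ IsManifold.maximalAtlas (𝓡 n) ∞ M,
    ∃ (a : M → Matrix (Fin n) (Fin n) ℝ) (b : M → Fin n → ℝ) (c : M → ℝ),
      (∀ i j, LocallyBoundedOn (fun x => a x i j) e.source) ∧
      (∀ i, LocallyBoundedOn (fun x => b x i) e.source) ∧
      LocallyBoundedOn c e.source ∧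
      (∀ x ∈ e.source, (a x).IsSymm) ∧
      (∀ p ∈ e.source, ∃ δ : ℝ, 0 < δ ∧ ∀ᶠ x in 𝓝[e.source] p,
        ∀ μ : ℝ, Module.End.HasEigenvalue (Matrix.toLin' (a x)) μ → δ ≤ μ) ∧
      ∀ φ : M → ℝ, ContMDiff (𝓡 n) 𝓘(ℝ, ℝ) 2 φ → ∀ x ∈ e.source,
        A φ x = (∑ i, ∑ j, a x i j * pderiv i (pderiv j (φ ∘ e.symm)) (e x))
          + (∑ i, b x i * pderiv i (φ ∘ e.symm) (e x)) + c x * φ x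

/-- An exhaustion function: every strict sublevel set is relatively compact. -/
def IsExhaustion {X : Type*} [TopologicalSpace X] (ρ : X → ℝ) : Prop :=
  ∀ a : ℝ, IsCompact (closure {x | ρ x < a})

variable [IsManifold (𝓡 n) ∞ M]

/-- A smooth Riemannian metric on `M`. -/
abbrev SmoothMetric (n : ℕ) (M : Type*) [TopologicalSpace M]
    [ChartedSpace (EuclideanSpace ℝ (Fin n)) M] [IsManifold (𝓡 n) ∞ M] :=
  Bundle.ContMDiffRiemannianMetric (𝓡 n) ∞ (EuclideanSpace ℝ (Fin n))
    (fun x : M => TangentSpace (𝓡 n) x)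

/-- The coordinate vector field `∂/∂xᵢ` of the chart `e`, at the point with coordinates `y`. -/
def coordVec (e : OpenPartialHomeomorph M (EuclideanSpace ℝ (Fin n))) (i : Fin n)
    (y : EuclideanSpace ℝ (Fin n)) : TangentSpace (𝓡 n) (e.symm y) :=
  mfderiv (𝓡 n) (𝓡 n) e.symm y (EuclideanSpace.single i (1 : ℝ) : EuclideanSpace ℝ (Fin n))

/-- The matrix `(gᵢⱼ)` of the metric in the chart `e`, as a function of the coordinates. -/
def metricMatrix (g : SmoothMetric n M) (e : OpenPartialHomeomorph M (EuclideanSpace ℝ (Fin n)))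
    (y : EuclideanSpace ℝ (Fin n)) : Matrix (Fin n) (Fin n) ℝ :=
  Matrix.of fun i j => g.inner (e.symm y) (coordVec e i y) (coordVec e j y)

/-- The Laplace operator of `g` in the chart `e`:
`Δ_g φ = G^{-1/2} ∑ ∂/∂xᵢ [gⁱʲ √G ∂φ/∂xⱼ]`, with `G = det (gᵢⱼ)` and `(gⁱʲ) = (gᵢⱼ)⁻¹`. -/
def laplaceInChart (g : SmoothMetric n M)
    (e : OpenPartialHomeomorph M (EuclideanSpace ℝ (Fin n))) (φ : M → ℝ) (x : M) : ℝ :=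
  1 / √(metricMatrix g e (e x)).det * ∑ i, ∑ j,
    pderiv i (fun y => (metricMatrix g e y)⁻¹ i j * √(metricMatrix g e y).det
      * pderiv j (φ ∘ e.symm) y) (e x)

/-- A `C²` function is strictly subharmonic with respect to `g` if `Δ_g φ > 0` everywhere,
`Δ_g` being computed in any local coordinate system of the smooth structure. -/
def IsStrictlySubharmonic (g : SmoothMetric n M) (φ : M → ℝ) : Prop :=
  ContMDiff (𝓡 n) 𝓘(ℝ, ℝ) 2 φ ∧
    ∀ e ∈ IsManifold.maximalAtlas (𝓡 n) ∞ M, ∀ x ∈ e.source, 0 < laplaceInChart g e φ x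

end

end EllipticExhaustion

end

noncomputable section

namespace EllipticExhaustion

/-! ### Successor maps on infinite graphs and recursive choices -/

/-- The set of descendants of an accessible vertex of a finitely branching relation is finite. -/
lemma finite_reflTransGen_of_acc {V : Type*} {r : V → V → Prop}
    (hfin : ∀ v, {w | r w v}.Finite) {v : V} (hv : Acc r v) :
    {w | Relation.ReflTransGen r w v}.Finite := by
  induction hv with
  | intro v _ ih =>
    have : {w | Relation.ReflTransGen r w v} ⊆
        {v} ∪ ⋃ u ∈ {u | r u v}, {w | Relation.ReflTransGen r w u} := by
      intro w hw
      rcases Relation.ReflTransGen.cases_tail hw with h | ⟨u, hwu, huv⟩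
      · exact Or.inl h.symm
      · exact Or.inr (Set.mem_biUnion (show u ∈ {u | r u v} from huv) hwu)
    exact ((Set.finite_singleton v).union ((hfin v).biUnion fun u hu => ih u hu)).subset this

lemma exists_adj_dist_lt {V : Type*} {G : SimpleGraph V} (hG : G.Connected) (r : V) {v : V}
    (hv : v ≠ r) : ∃ w, G.Adj v w ∧ G.dist w r < G.dist v r := by
  obtain ⟨p, hp⟩ := hG.exists_walk_length_eq_dist v r
  cases p with
  | nil => exact absurd rfl hv
  | cons h q =>
    refine ⟨_, h, ?_⟩
    have := SimpleGraph.dist_le q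
    rw [SimpleGraph.Walk.length_cons] at hp
    omega

/-- In an infinite connected locally finite graph one can move from every vertex to a neighbour
in such a way that tracing the moves backwards always stops. -/
lemma exists_adj_wellFounded {V : Type*} [Infinite V] {G : SimpleGraph V} (hG : G.Connected)
    (hfin : ∀ v, (G.neighborSet v).Finite) :
    ∃ s : V → V, (∀ v, G.Adj v (s v)) ∧ WellFounded fun w v => s w = v := by
  classical
  obtain ⟨r⟩ := hG.nonempty
  choose! p hp using fun v (hv : v ≠ r) => exists_adj_dist_lt hG r hv
  let c : V → V → Prop := fun w v => w ≠ r ∧ p w = v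
  have hcfin : ∀ v, {w | c w v}.Finite := fun v =>
    (hfin v).subset fun w hw => by
      have := (hp w hw.1).1
      rw [hw.2] at this
      exact this.symm
  have hdesc : ∀ (k : ℕ) (w : V), G.dist w r = k → Relation.ReflTransGen c w r := by
    intro k
    induction k using Nat.strong_induction_on with
    | _ k ih =>
      intro w hw
      by_cases h : w = r
      · rw [h]
      · exact Relation.ReflTransGen.head ⟨h, rfl⟩ (ih _ (hw ▸ (hp w h).2) _ rfl)
  -- Every vertex descends from the root and `V` is infinite.
  have hr : ¬ Acc c r := fun h => by
    have := finite_reflTransGen_of_acc hcfin h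
    exact Set.infinite_univ (this.subset fun w _ => hdesc _ w rfl)
  have hchild : ∀ v, ¬ Acc c v → ∃ w, c w v ∧ ¬ Acc c w := by
    intro v hv
    by_contra! h
    exact hv (Acc.intro v h)
  choose! d hd using hchild
  -- From an accessible vertex step towards the root; from any other vertex step outwards, to a
  -- child that is again not accessible.
  let s : V → V := fun v => if Acc c v then p v else d v
  have hs₁ : ∀ v, Acc c v → s v = p v := fun v hv => if_pos hv
  have hs₂ : ∀ v, ¬ Acc c v → s v = d v := fun v hv => if_neg hv
  -- Outward steps land only on inaccessible vertices, so a predecessor of an accessible vertex is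
  -- an accessible child of it.
  have hacc : ∀ v, Acc c v → Acc (fun w v => s w = v) v := by
    intro v hv
    induction hv with
    | intro v hv' ih =>
      refine Acc.intro v fun w hw => ?_
      by_cases h : Acc c w
      · refine ih w ⟨fun hwr => hr (hwr ▸ h), ?_⟩
        rw [← hs₁ w h, hw]
      · refine absurd (Acc.intro v hv') ?_
        rw [← hw, hs₂ w h]
        exact (hd w h).2
  -- An inaccessible predecessor of `v` is its parent and so is nearer to the root; the accessible
  -- ones are covered by `hacc`.
  have hacc' : ∀ (k : ℕ) (v : V), G.dist v r = k → Acc (fun w v => s w = v) v := by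
    intro k
    induction k using Nat.strong_induction_on with
    | _ k ih =>
      intro v hk
      refine Acc.intro v fun w hw => ?_
      by_cases h : Acc c w
      · exact hacc w h
      · rw [hs₂ w h] at hw
        have hcw := (hd w h).1
        rw [hw] at hcw
        have := (hp v hcw.1).2
        rw [hcw.2] at this
        exact ih _ (hk ▸ this) w rfl
  refine ⟨s, fun v => ?_, ⟨fun v => hacc' _ v rfl⟩⟩
  by_cases h : Acc c v
  · rw [hs₁ v h]
    exact (hp v fun hvr => hr (hvr ▸ h)).1
  · rw [hs₂ v h]
    have hc := (hd v h).1
    have := (hp _ hc.1).1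
    rw [hc.2] at this
    exact this.symm

/-- Along a well-founded relation with finite fibres one can choose coefficients recursively. -/
lemma exists_coeff_of_wellFounded {V : Type*} {s : V → V}
    (hs : WellFounded fun w v => s w = v) (hfin : ∀ v, {w | s w = v}.Finite)
    (F : V → ℝ → ℝ) (D : V → ℝ) :
    ∃ C : V → ℝ, ∀ v, C v = F v (∑ w ∈ (hfin v).toFinset, C w * D w) := by
  classical
  let step : ∀ v, (∀ w, s w = v → ℝ) → ℝ := fun v rec =>
    F v (∑ w ∈ (hfin v).toFinset.attach,
      rec w.1 ((hfin v).mem_toFinset.1 w.2) * D w.1)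
  refine ⟨hs.fix step, fun v => ?_⟩
  rw [WellFounded.fix_eq]
  simp only [step]
  rw [← Finset.sum_attach (hfin v).toFinset]

/-- Greedy choice along an enumeration of `ι`: only finitely many points have been used before each
stage. -/
lemma exists_injective_forall_mem {ι X : Type*} [Countable ι] {S : ι → Set X}
    (hS : ∀ i, (S i).Infinite) : ∃ q : ι → X, Function.Injective q ∧ ∀ i, q i ∈ S i := by
  classical
  obtain ⟨f, hf⟩ := exists_injective_nat ι
  have key : ∀ (i : ι) (t : Finset X), ∃ x ∈ S i, x ∉ t := fun i t =>
    (hS i).exists_notMem_finset t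
  choose pick hpick hpick' using key
  have hwf : WellFounded fun i j => f i < f j := InvImage.wf f Nat.lt_wfRel.wf
  have hfin : ∀ i, {j | f j < f i}.Finite := fun i =>
    (Set.finite_lt_nat (f i)).preimage hf.injOn
  let step : ∀ i, (∀ j, f j < f i → X) → X := fun i rec =>
    pick i ((hfin i).toFinset.attach.image fun j => rec j.1 ((hfin i).mem_toFinset.1 j.2))
  have heq : ∀ i, hwf.fix step i = step i fun j _ => hwf.fix step j := fun i => hwf.fix_eq step i
  have hne : ∀ i j, f j < f i → hwf.fix step j ≠ hwf.fix step i := by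
    intro i j hij h
    rw [heq i] at h
    refine hpick' i ((hfin i).toFinset.attach.image fun j => hwf.fix step j.1) ?_
    exact Finset.mem_image.2 ⟨⟨j, (hfin i).mem_toFinset.2 hij⟩, Finset.mem_attach _ _, h⟩
  refine ⟨hwf.fix step, fun i j hij => ?_, fun i => ?_⟩
  · by_contra h
    rcases lt_or_gt_of_ne (hf.ne h) with h' | h'
    · exact hne _ _ h' hij
    · exact hne _ _ h' hij.symm
  · rw [heq i]
    exact hpick _ _

/-! ### Calculus of partial derivatives, in coordinates and in charts -/

section pderiv

variable {n : ℕ} {f g : EuclideanSpace ℝ (Fin n) → ℝ} {y : EuclideanSpace ℝ (Fin n)}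

lemma pderiv_congr (h : f =ᶠ[𝓝 y] g) (i : Fin n) : pderiv i f =ᶠ[𝓝 y] pderiv i g :=
  (h.fderiv (𝕜 := ℝ)).mono fun z hz => by simp only [pderiv, hz]

lemma pderiv_add (hf : DifferentiableAt ℝ f y) (hg : DifferentiableAt ℝ g y) (i : Fin n) :
    pderiv i (f + g) y = pderiv i f y + pderiv i g y := by
  simp only [pderiv, fderiv_add hf hg, add_apply]

lemma pderiv_mul (hf : DifferentiableAt ℝ f y) (hg : DifferentiableAt ℝ g y) (i : Fin n) :
    pderiv i (fun z => f z * g z) y = f y * pderiv i g y + pderiv i f y * g y := by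
  have := fderiv_mul hf hg
  simp only [pderiv]
  change fderiv ℝ (f * g) y _ = _
  rw [this]
  simp [mul_comm]

lemma pderiv_const_mul (hf : DifferentiableAt ℝ f y) (c : ℝ) (i : Fin n) :
    pderiv i (fun z => c * f z) y = c * pderiv i f y := by
  simp [pderiv, fderiv_const_mul hf]

lemma contDiffAt_pderiv {k m : WithTop ℕ∞} (hf : ContDiffAt ℝ m f y) (hk : k + 1 ≤ m)
    (i : Fin n) : ContDiffAt ℝ k (pderiv i f) y :=
  (hf.fderiv_right hk).clm_apply contDiffAt_const

lemma contDiff_pderiv {k m : WithTop ℕ∞} (hf : ContDiff ℝ m f) (hk : k + 1 ≤ m)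
    (i : Fin n) : ContDiff ℝ k (pderiv i f) :=
  (hf.fderiv_right hk).clm_apply contDiff_const

lemma pderiv_comp {h : ℝ → ℝ} {h' : ℝ} (hh : HasDerivAt h h' (f y)) (hf : DifferentiableAt ℝ f y)
    (i : Fin n) : pderiv i (fun z => h (f z)) y = h' * pderiv i f y := by
  have := (hh.comp_hasFDerivAt y hf.hasFDerivAt).fderiv
  simp only [pderiv]
  change fderiv ℝ (h ∘ f) y _ = _
  rw [this]
  simp

lemma eventually_differentiableAt (hf : ContDiffAt ℝ 2 f y) :
    ∀ᶠ z in 𝓝 y, DifferentiableAt ℝ f z :=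
  (hf.eventually (by simp)).mono fun _ hz => hz.differentiableAt (by simp)

lemma pderiv_pderiv_add (hf : ContDiffAt ℝ 2 f y) (hg : ContDiffAt ℝ 2 g y) (i j : Fin n) :
    pderiv i (pderiv j (f + g)) y = pderiv i (pderiv j f) y + pderiv i (pderiv j g) y := by
  have h : pderiv j (f + g) =ᶠ[𝓝 y] pderiv j f + pderiv j g := by
    filter_upwards [eventually_differentiableAt hf, eventually_differentiableAt hg] with z h₁ h₂
    exact pderiv_add h₁ h₂ j
  rw [(pderiv_congr h i).self_of_nhds, pderiv_add
    ((contDiffAt_pderiv hf (k := 1) (by norm_num) j).differentiableAt (by simp))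
    ((contDiffAt_pderiv hg (k := 1) (by norm_num) j).differentiableAt (by simp))]

lemma pderiv_pderiv_const_mul (hf : ContDiffAt ℝ 2 f y) (c : ℝ) (i j : Fin n) :
    pderiv i (pderiv j (fun z => c * f z)) y = c * pderiv i (pderiv j f) y := by
  have h : pderiv j (fun z => c * f z) =ᶠ[𝓝 y] fun z => c * pderiv j f z := by
    filter_upwards [eventually_differentiableAt hf] with z h₁
    exact pderiv_const_mul h₁ c j
  rw [(pderiv_congr h i).self_of_nhds, pderiv_const_mul
    ((contDiffAt_pderiv hf (k := 1) (by norm_num) j).differentiableAt (by simp))]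

end pderiv

section chart

variable {n : ℕ} {M : Type*} [TopologicalSpace M]

lemma comp_symm_eventuallyEq {e : OpenPartialHomeomorph M (EuclideanSpace ℝ (Fin n))}
    {φ ψ : M → ℝ} {x : M} (hx : x ∈ e.source) (h : φ =ᶠ[𝓝 x] ψ) :
    φ ∘ e.symm =ᶠ[𝓝 (e x)] ψ ∘ e.symm := by
  have := e.symm.continuousAt (x := e x) (by simpa using e.map_source hx)
  rw [ContinuousAt, OpenPartialHomeomorph.left_inv _ hx] at this
  exact this.eventually h

lemma continuousOn_comp_chart {e : OpenPartialHomeomorph M (EuclideanSpace ℝ (Fin n))}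
    {f : EuclideanSpace ℝ (Fin n) → ℝ} (hf : ∀ y ∈ e.target, ContinuousAt f y) :
    ContinuousOn (fun x => f (e x)) e.source := fun _ hx =>
  ((hf _ (e.map_source hx)).comp (e.continuousAt hx)).continuousWithinAt

variable [ChartedSpace (EuclideanSpace ℝ (Fin n)) M]

lemma contMDiff_const_mul {k : WithTop ℕ∞} {φ : M → ℝ}
    (hφ : ContMDiff (𝓡 n) 𝓘(ℝ, ℝ) k φ) (t : ℝ) :
    ContMDiff (𝓡 n) 𝓘(ℝ, ℝ) k fun z => t * φ z :=
  contMDiff_const.mul hφ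

lemma contDiffAt_comp_symm {e : OpenPartialHomeomorph M (EuclideanSpace ℝ (Fin n))}
    (he : e ∈ IsManifold.maximalAtlas (𝓡 n) ∞ M) {k : ℕ∞} {φ : M → ℝ}
    {y : EuclideanSpace ℝ (Fin n)} (hy : y ∈ e.target)
    (hφ : ContMDiffAt (𝓡 n) 𝓘(ℝ, ℝ) k φ (e.symm y)) : ContDiffAt ℝ k (φ ∘ e.symm) y := by
  rw [← contMDiffAt_iff_contDiffAt]
  refine ContMDiffAt.comp y hφ ?_
  exact ((contMDiffOn_symm_of_mem_maximalAtlas he).contMDiffAt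
    (e.open_target.mem_nhds hy)).of_le (by exact_mod_cast le_top)

end chart

/-! ### Locality, linearity and local boundedness of the operator -/

section operator

variable {n : ℕ} {M : Type*} [TopologicalSpace M] [ChartedSpace (EuclideanSpace ℝ (Fin n)) M]
  [IsManifold (𝓡 n) ∞ M] {A : (M → ℝ) → (M → ℝ)}

namespace IsLocallyUniformlyElliptic

/-- Locality of `A` reduces a locally finite sum to a finite one near each point, where `map_sum`
applies. -/
lemma congr_of_eventuallyEq (hA : IsLocallyUniformlyElliptic (n := n) A) {φ ψ : M → ℝ}
    (hφ : ContMDiff (𝓡 n) 𝓘(ℝ, ℝ) 2 φ) (hψ : ContMDiff (𝓡 n) 𝓘(ℝ, ℝ) 2 ψ) {x : M}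
    (h : φ =ᶠ[𝓝 x] ψ) : A φ x = A ψ x := by
  obtain ⟨a, b, c, -, -, -, -, -, hf⟩ :=
    hA _ (IsManifold.chart_mem_maximalAtlas (I := 𝓡 n) (n := ∞) x)
  have hx := mem_chart_source (EuclideanSpace ℝ (Fin n)) x
  have he := comp_symm_eventuallyEq hx h
  rw [hf φ hφ x hx, hf ψ hψ x hx, h.self_of_nhds]
  simp only [(pderiv_congr he _).self_of_nhds,
    fun i j => (pderiv_congr (pderiv_congr he j) i).self_of_nhds]

lemma map_add (hA : IsLocallyUniformlyElliptic (n := n) A) {φ ψ : M → ℝ}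
    (hφ : ContMDiff (𝓡 n) 𝓘(ℝ, ℝ) 2 φ) (hψ : ContMDiff (𝓡 n) 𝓘(ℝ, ℝ) 2 ψ) (x : M) :
    A (φ + ψ) x = A φ x + A ψ x := by
  have he := IsManifold.chart_mem_maximalAtlas (I := 𝓡 n) (n := ∞) x
  obtain ⟨a, b, c, -, -, -, -, -, hf⟩ := hA _ he
  have hx := mem_chart_source (EuclideanSpace ℝ (Fin n)) x
  have hy := (chartAt (EuclideanSpace ℝ (Fin n)) x).map_source hx
  have h₁ := contDiffAt_comp_symm (k := 2) he hy hφ.contMDiffAt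
  have h₂ := contDiffAt_comp_symm (k := 2) he hy hψ.contMDiffAt
  have h₁' := h₁.differentiableAt (by simp)
  have h₂' := h₂.differentiableAt (by simp)
  rw [hf _ (hφ.add hψ) x hx, hf φ hφ x hx, hf ψ hψ x hx]
  have hcomp : ∀ e : OpenPartialHomeomorph M (EuclideanSpace ℝ (Fin n)),
      (φ + ψ) ∘ e.symm = φ ∘ e.symm + ψ ∘ e.symm := fun e => rfl
  simp only [hcomp, pderiv_pderiv_add h₁ h₂, pderiv_add h₁' h₂', mul_add,
    Finset.sum_add_distrib, Pi.add_apply]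
  ring

lemma map_const_mul (hA : IsLocallyUniformlyElliptic (n := n) A) {φ : M → ℝ}
    (hφ : ContMDiff (𝓡 n) 𝓘(ℝ, ℝ) 2 φ) (t : ℝ) (x : M) :
    A (fun z => t * φ z) x = t * A φ x := by
  have he := IsManifold.chart_mem_maximalAtlas (I := 𝓡 n) (n := ∞) x
  obtain ⟨a, b, c, -, -, -, -, -, hf⟩ := hA _ he
  have hx := mem_chart_source (EuclideanSpace ℝ (Fin n)) x
  have hy := (chartAt (EuclideanSpace ℝ (Fin n)) x).map_source hx
  have h₁ := contDiffAt_comp_symm (k := 2) he hy hφ.contMDiffAt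
  have h₁' := h₁.differentiableAt (by simp)
  rw [hf _ (contMDiff_const_mul hφ t) x hx, hf φ hφ x hx]
  have hcomp : ∀ e : OpenPartialHomeomorph M (EuclideanSpace ℝ (Fin n)),
      (fun z => t * φ z) ∘ e.symm = fun z => t * (φ ∘ e.symm) z := fun e => rfl
  simp only [hcomp, pderiv_pderiv_const_mul h₁, pderiv_const_mul h₁', mul_add, Finset.mul_sum]
  congr 1
  · congr 1
    · exact Finset.sum_congr rfl fun i _ => Finset.sum_congr rfl fun j _ => by ring
    · exact Finset.sum_congr rfl fun i _ => by ring
  · ring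

lemma map_sum (hA : IsLocallyUniformlyElliptic (n := n) A) {ι : Type*} (s : Finset ι)
    (C : ι → ℝ) {φ : ι → M → ℝ} (hφ : ∀ i, ContMDiff (𝓡 n) 𝓘(ℝ, ℝ) 2 (φ i)) (x : M) :
    A (fun z => ∑ i ∈ s, C i * φ i z) x = ∑ i ∈ s, C i * A (φ i) x := by
  classical
  induction s using Finset.induction_on with
  | empty =>
    have := hA.map_const_mul (φ := fun _ => 0) contMDiff_const 0 x
    simpa using this
  | insert i s hi ih =>
    have h : (fun z => ∑ j ∈ insert i s, C j * φ j z) =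
        (fun z => C i * φ i z) + fun z => ∑ j ∈ s, C j * φ j z := by
      funext z
      simp [Finset.sum_insert hi]
    rw [h, hA.map_add (contMDiff_const_mul (hφ i) _)
      (contMDiff_finsetSum fun j _ => contMDiff_const_mul (hφ j) _), ih,
      hA.map_const_mul (hφ i), Finset.sum_insert hi]

end IsLocallyUniformlyElliptic

lemma LocallyBoundedOn.exists_bound {X : Type*} [TopologicalSpace X] {f : X → ℝ} {U K : Set X}
    (hf : LocallyBoundedOn f U) (hK : IsCompact K) (hKU : K ⊆ U) :
    ∃ C : ℝ, 0 ≤ C ∧ ∀ x ∈ K, |f x| ≤ C := by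
  refine hK.induction_on (p := fun s => ∃ C : ℝ, 0 ≤ C ∧ ∀ x ∈ s, |f x| ≤ C)
    ⟨0, le_rfl, by simp⟩ ?_ ?_ ?_
  · rintro s t hst ⟨C, h0, h⟩
    exact ⟨C, h0, fun x hx => h x (hst hx)⟩
  · rintro s t ⟨C, h0, h⟩ ⟨C', h0', h'⟩
    exact ⟨max C C', le_max_of_le_left h0, fun x hx => hx.elim
      (fun hx => (h x hx).trans (le_max_left _ _)) fun hx => (h' x hx).trans (le_max_right _ _)⟩
  · intro x hx
    obtain ⟨C, hC⟩ := hf x (hKU hx)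
    refine ⟨_, nhdsWithin_mono x hKU hC, |C|, abs_nonneg _, fun y hy => ?_⟩
    exact le_trans hy (le_abs_self C)

lemma _root_.ContinuousOn.locallyBoundedOn {X : Type*} [TopologicalSpace X] {f : X → ℝ} {U : Set X}
    (hf : ContinuousOn f U) : LocallyBoundedOn f U := fun p hp =>
  ⟨|f p| + 1, ((hf p hp).abs.eventually_lt_const (lt_add_one _)).mono fun _ h => h.le⟩

namespace LocallyBoundedOn

variable {X : Type*} [TopologicalSpace X] {f g : X → ℝ} {U : Set X}

lemma add (hf : LocallyBoundedOn f U) (hg : LocallyBoundedOn g U) :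
    LocallyBoundedOn (fun x => f x + g x) U := fun p hp => by
  obtain ⟨C, hC⟩ := hf p hp
  obtain ⟨D, hD⟩ := hg p hp
  refine ⟨C + D, ?_⟩
  filter_upwards [hC, hD] with x h₁ h₂ using (abs_add_le _ _).trans (add_le_add h₁ h₂)

lemma mul (hf : LocallyBoundedOn f U) (hg : LocallyBoundedOn g U) :
    LocallyBoundedOn (fun x => f x * g x) U := fun p hp => by
  obtain ⟨C, hC⟩ := hf p hp
  obtain ⟨D, hD⟩ := hg p hp
  refine ⟨C * D, ?_⟩
  filter_upwards [hC, hD] with x h₁ h₂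
  rw [abs_mul]
  exact mul_le_mul h₁ h₂ (abs_nonneg _) ((abs_nonneg _).trans h₁)

lemma sum {ι : Type*} (s : Finset ι) {f : ι → X → ℝ} (hf : ∀ i, LocallyBoundedOn (f i) U) :
    LocallyBoundedOn (fun x => ∑ i ∈ s, f i x) U := by
  classical
  induction s using Finset.induction_on with
  | empty => exact fun p _ => ⟨0, by simp⟩
  | insert i s hi ih =>
    simp only [Finset.sum_insert hi]
    exact (hf i).add ih

lemma congr (hf : LocallyBoundedOn f U) (h : ∀ x ∈ U, g x = f x) : LocallyBoundedOn g U :=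
  fun p hp => by
    obtain ⟨C, hC⟩ := hf p hp
    refine ⟨C, ?_⟩
    filter_upwards [hC, self_mem_nhdsWithin] with x h₁ h₂
    rwa [h x h₂]

end LocallyBoundedOn

/-- The derivatives of a `C²` function are continuous in a chart and the coefficients are locally
bounded. This bounds the defect of a bump on a compact set. -/
lemma IsLocallyUniformlyElliptic.locallyBoundedOn (hA : IsLocallyUniformlyElliptic (n := n) A)
    {φ : M → ℝ} (hφ : ContMDiff (𝓡 n) 𝓘(ℝ, ℝ) 2 φ) : LocallyBoundedOn (A φ) Set.univ := by
  intro p _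
  have he := IsManifold.chart_mem_maximalAtlas (I := 𝓡 n) (n := ∞) p
  set e := chartAt (EuclideanSpace ℝ (Fin n)) p
  obtain ⟨a, b, c, ha, hb, hc, -, -, hf⟩ := hA e he
  have hC : ∀ y ∈ e.target, ContDiffAt ℝ 2 (φ ∘ e.symm) y := fun y hy =>
    contDiffAt_comp_symm (k := 2) he hy hφ.contMDiffAt
  have h₁ : ∀ j, ∀ y ∈ e.target, ContDiffAt ℝ 1 (pderiv j (φ ∘ e.symm)) y := fun j y hy =>
    contDiffAt_pderiv (hC y hy) (by norm_num) j
  have h₂ : ∀ i j, ∀ y ∈ e.target, ContDiffAt ℝ 0 (pderiv i (pderiv j (φ ∘ e.symm))) y :=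
    fun i j y hy => contDiffAt_pderiv (h₁ j y hy) (by norm_num) i
  have hb := LocallyBoundedOn.congr (U := e.source) (g := A φ) (.add (.add
      (.sum Finset.univ fun i => .sum Finset.univ fun j => (ha i j).mul
        (continuousOn_comp_chart fun y hy => (h₂ i j y hy).continuousAt).locallyBoundedOn)
      (.sum Finset.univ fun i => (hb i).mul
        (continuousOn_comp_chart fun y hy => (h₁ i y hy).continuousAt).locallyBoundedOn))
      (hc.mul hφ.continuous.continuousOn.locallyBoundedOn)) fun x hx => hf φ hφ x hx
  have hp := mem_chart_source (EuclideanSpace ℝ (Fin n)) p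
  have := hb p hp
  rwa [e.open_source.nhdsWithin_eq hp, ← nhdsWithin_univ] at this

end operator

lemma two_le_infty : (2 : WithTop ℕ∞) ≤ ∞ :=
  WithTop.coe_le_coe.2 (le_top : (2 : ℕ∞) ≤ ⊤)

lemma one_add_one_le_infty : (1 + 1 : WithTop ℕ∞) ≤ ∞ := by
  rw [one_add_one_eq_two]
  exact two_le_infty

/-! ### Bumps whose defect is confined near one point -/

section

open Matrix

/-- A symmetric matrix whose eigenvalues are at least `δ` defines a quadratic form that is bounded
below by `δ` times the sum of squares. -/
lemma mul_sum_sq_le_of_eigenvalues {n : ℕ} {a : Matrix (Fin n) (Fin n) ℝ} (ha : a.IsSymm) {δ : ℝ}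
    (hδ : ∀ μ : ℝ, Module.End.HasEigenvalue (Matrix.toLin' a) μ → δ ≤ μ) (ξ : Fin n → ℝ) :
    δ * ∑ i, ξ i ^ 2 ≤ ∑ i, ∑ j, a i j * (ξ i * ξ j) := by
  have hH : (a - δ • (1 : Matrix (Fin n) (Fin n) ℝ)).IsHermitian := by
    ext i j
    simp [ha.apply i j, Matrix.one_apply, eq_comm]
  -- An eigenvector of `a - δ` for `λ` is an eigenvector of `a` for `λ + δ`, so `λ ≥ 0`.
  have hpsd : (a - δ • (1 : Matrix (Fin n) (Fin n) ℝ)).PosSemidef := by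
    rw [hH.posSemidef_iff_eigenvalues_nonneg]
    intro i
    have h := hH.mulVec_eigenvectorBasis i
    set v := hH.eigenvectorBasis i
    have hv : (v : Fin n → ℝ) ≠ 0 := fun h0 => by
      have : v = 0 := by
        ext j
        exact congrFun h0 j
      have h1 := hH.eigenvectorBasis.orthonormal.1 i
      rw [show hH.eigenvectorBasis i = 0 from this] at h1
      simp at h1
    rw [sub_mulVec, smul_mulVec, one_mulVec, sub_eq_iff_eq_add, ← add_smul] at h
    have := hδ _ (Module.End.hasEigenvalue_of_hasEigenvector (x := (v : Fin n → ℝ))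
      ⟨Module.End.mem_eigenspace_iff.2 (by rw [Matrix.toLin'_apply, h]), hv⟩)
    simpa using this
  have h := hpsd.dotProduct_mulVec_nonneg ξ
  rw [sub_mulVec, smul_mulVec, one_mulVec, dotProduct_sub, dotProduct_smul, star_trivial,
    sub_nonneg] at h
  refine le_of_eq_of_le ?_ (h.trans_eq ?_)
  · simp [dotProduct, pow_two]
  · simp only [dotProduct, mulVec, Finset.mul_sum]
    exact Finset.sum_congr rfl fun i _ => Finset.sum_congr rfl fun j _ => by ring

end

section profile

open Metric
open scoped RealInnerProductSpace

/-- For a point `q` of the ball `B(z, R)` there is a smooth function that is positive exactly on the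
ball and whose only critical point in the closed ball is `q`. -/
lemma exists_contDiff_pos_iff_mem_ball {E : Type*} [NormedAddCommGroup E] [InnerProductSpace ℝ E]
    {q z : E} {R : ℝ} (hq : q ∈ ball z R) :
    ∃ f : E → ℝ, ContDiff ℝ ∞ f ∧ (∀ y, 0 < f y ↔ y ∈ ball z R) ∧
      ∀ y ∈ closedBall z R, fderiv ℝ f y = 0 → y = q := by
  rw [mem_ball_iff_norm] at hq
  have hR : 0 < R := (norm_nonneg _).trans_lt hq
  set N : ℝ := R ^ 2 - ‖q - z‖ ^ 2 with hN
  have hN0 : 0 < N := by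
    have := pow_lt_pow_left₀ hq (norm_nonneg _) two_ne_zero
    linarith
  -- The gradient of the function below is a positive factor times `(R² - ‖y - z‖²) l - 2 (y - z)`;
  -- this `l` makes it vanish at `y = q`.
  obtain ⟨l, hl⟩ : ∃ l : E, l = (2 / N) • (q - z) := ⟨_, rfl⟩
  refine ⟨fun y => (R ^ 2 - ‖y - z‖ ^ 2) * Real.exp ⟪l, y - z⟫, ?_, fun y => ?_, fun y hy h => ?_⟩
  · exact (contDiff_const.sub ((contDiff_id.sub contDiff_const).norm_sq ℝ)).mul
      (contDiff_const.inner ℝ (contDiff_id.sub contDiff_const)).exp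
  · rw [mul_pos_iff_of_pos_right (Real.exp_pos _), sub_pos, mem_ball_iff_norm,
      pow_lt_pow_iff_left₀ (norm_nonneg _) hR.le two_ne_zero]
  · have hd : HasFDerivAt (fun y : E => y - z) (ContinuousLinearMap.id ℝ E) y :=
      (hasFDerivAt_id y).sub_const z
    have h1 := (hd.norm_sq.const_sub (R ^ 2)).mul
      ((hasFDerivAt_const l y).inner ℝ hd).exp
    have h2 := h1.fderiv
    have h3 : fderiv ℝ (fun y => (R ^ 2 - ‖y - z‖ ^ 2) * Real.exp ⟪l, y - z⟫) y = _ := h2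
    rw [h] at h3
    have h4 : ∀ v, ⟪(R ^ 2 - ‖y - z‖ ^ 2) • l - (2 : ℝ) • (y - z), v⟫ = 0 := by
      intro v
      have h5 := congrArg (fun T : E →L[ℝ] ℝ => T v) h3
      simp at h5
      have h6 : Real.exp ⟪l, y - z⟫ *
          ⟪(R ^ 2 - ‖y - z‖ ^ 2) • l - (2 : ℝ) • (y - z), v⟫ = 0 := by
        have e1 : ⟪(R ^ 2 - ‖y - z‖ ^ 2) • l - (2 : ℝ) • (y - z), v⟫ =
            (R ^ 2 - ‖y - z‖ ^ 2) * ⟪l, v⟫ - 2 * (⟪y, v⟫ - ⟪z, v⟫) := by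
          rw [inner_sub_left, real_inner_smul_left, real_inner_smul_left, inner_sub_left]
        rw [e1]
        linarith
      exact (mul_eq_zero.1 h6).resolve_left (Real.exp_pos _).ne'
    have h5 := h4 ((R ^ 2 - ‖y - z‖ ^ 2) • l - (2 : ℝ) • (y - z))
    rw [inner_self_eq_zero, sub_eq_zero] at h5
    set t : ℝ := (R ^ 2 - ‖y - z‖ ^ 2) / N with ht
    have h6 : y - z = t • (q - z) := by
      have : (2 : ℝ) • (y - z) = (2 : ℝ) • (t • (q - z)) := by
        rw [← h5, hl, smul_smul, smul_smul]
        congr 1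
        rw [ht]
        ring
      exact smul_right_injective E (two_ne_zero (α := ℝ)) this
    have ht0 : 0 ≤ t := by
      refine div_nonneg ?_ hN0.le
      have := pow_le_pow_left₀ (norm_nonneg _) (mem_closedBall_iff_norm.1 hy) 2
      linarith
    have h7 : t * N = R ^ 2 - t ^ 2 * ‖q - z‖ ^ 2 := by
      rw [← mul_pow, ← Real.norm_of_nonneg ht0, ← norm_smul, Real.norm_of_nonneg ht0, ← h6, ht]
      field_simp
    -- A critical point has `y - z = t (q - z)`, and `t` solves a quadratic equation with root `1`.
    -- The other factor is positive because `t ≥ 0` in the closed ball.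
    have h8 : (t - 1) * (N + (t + 1) * ‖q - z‖ ^ 2) = 0 := by
      linear_combination h7 - hN
    have h9 : t = 1 := by
      rcases mul_eq_zero.1 h8 with h | h
      · linarith
      · have : 0 ≤ (t + 1) * ‖q - z‖ ^ 2 := by positivity
        linarith
    rw [h9, one_smul] at h6
    exact sub_left_injective h6

end profile

lemma hasDerivAt_expNegInvGlue (s : ℝ) :
    HasDerivAt expNegInvGlue (s⁻¹ ^ 2 * expNegInvGlue s) s := by
  simpa using expNegInvGlue.hasDerivAt_polynomial_eval_inv_mul 1 s

lemma hasDerivAt_inv_sq_mul_expNegInvGlue (s : ℝ) :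
    HasDerivAt (fun s => s⁻¹ ^ 2 * expNegInvGlue s)
      ((s⁻¹ ^ 4 - 2 * s⁻¹ ^ 3) * expNegInvGlue s) s := by
  have := expNegInvGlue.hasDerivAt_polynomial_eval_inv_mul (Polynomial.X ^ 2) s
  simp only [Polynomial.eval_pow, Polynomial.eval_X, Polynomial.derivative_X_pow,
    Polynomial.eval_mul, Polynomial.eval_sub, Polynomial.eval_C] at this
  convert! this using 1
  push_cast
  ring

lemma continuous_inv_pow_mul_expNegInvGlue (k : ℕ) :
    Continuous fun s : ℝ => s⁻¹ ^ k * expNegInvGlue s := by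
  simpa using expNegInvGlue.continuous_polynomial_eval_inv_mul (Polynomial.X ^ k)

/-- For `s = κt > 0` and `h = exp(-1/s)`, factoring `s⁻⁴ κ² h` out of the right side leaves `(1 -
2s) Q + κ t² L + κ² t⁴ c`. This is at least `m` minus the left side of `hκ2`, hence at least `m /
2`. Here `Q` stands for the principal part on the gradient of `f`, and `L` for `A` without its
zeroth-order term, applied to `f`. -/
lemma convexified_lower_bound {F m C κ t Q L c : ℝ} (hκ : 0 < κ) (hκ1 : κ ≤ 1)
    (hF : 0 ≤ F) (hm : 0 < m) (hC : 0 ≤ C)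
    (hκ2 : κ * (2 * F * m + F ^ 2 * C + F ^ 4 * C) ≤ m / 2)
    (ht : 0 ≤ t) (htF : t ≤ F) (hQ : m ≤ Q) (hL : |L| ≤ C) (hc : |c| ≤ C) :
    κ ^ 2 * (m / 2) * ((κ * t)⁻¹ ^ 4 * expNegInvGlue (κ * t)) ≤
      ((κ * t)⁻¹ ^ 4 - 2 * (κ * t)⁻¹ ^ 3) * expNegInvGlue (κ * t) * κ ^ 2 * Q +
        (κ * t)⁻¹ ^ 2 * expNegInvGlue (κ * t) * κ * L + c * expNegInvGlue (κ * t) := by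
  rcases ht.eq_or_lt with rfl | ht
  · simp [expNegInvGlue.zero]
  have hs : 0 < κ * t := mul_pos hκ ht
  set h := expNegInvGlue (κ * t)
  have hh : 0 ≤ h := expNegInvGlue.nonneg _
  set w := (κ * t)⁻¹ with hw
  have hws : w * (κ * t) = 1 := inv_mul_cancel₀ hs.ne'
  have hw0 : 0 < w := inv_pos.2 hs
  have hX : 0 ≤ F ^ 2 * C := by positivity
  have hY : 0 ≤ F ^ 4 * C := by positivity
  have hFm : 0 ≤ F * m := by positivity
  have hL' : -C ≤ L := (abs_le.1 hL).1
  have hc' : -C ≤ c := (abs_le.1 hc).1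
  -- Keeps `1 - 2κt` positive, so that the lower bound on `Q` may be multiplied by it.
  have hκF : 2 * (κ * F) ≤ 1 / 2 := by
    by_contra! hcon
    have := mul_lt_mul_of_pos_right hcon hm
    nlinarith [mul_nonneg hκ.le hX, mul_nonneg hκ.le hY]
  have hκt : κ * t ≤ κ * F := mul_le_mul_of_nonneg_left htF hκ.le
  have key : 0 ≤ (1 - 2 * (κ * t)) * Q + κ * (t ^ 2 * L) + κ ^ 2 * (t ^ 4 * c) - m / 2 := by
    have h1 : (1 - 2 * (κ * F)) * m ≤ (1 - 2 * (κ * t)) * Q :=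
      mul_le_mul (by linarith) hQ hm.le (by linarith)
    have ht2 : t ^ 2 ≤ F ^ 2 := pow_le_pow_left₀ ht.le htF 2
    have ht4 : t ^ 4 ≤ F ^ 4 := pow_le_pow_left₀ ht.le htF 4
    have h2 : -(F ^ 2 * C) ≤ t ^ 2 * L := by
      have : t ^ 2 * (-C) ≤ t ^ 2 * L := mul_le_mul_of_nonneg_left hL' (by positivity)
      have := mul_le_mul_of_nonneg_right ht2 hC
      linarith
    have h3 : -(F ^ 4 * C) ≤ t ^ 4 * c := by
      have : t ^ 4 * (-C) ≤ t ^ 4 * c := mul_le_mul_of_nonneg_left hc' (by positivity)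
      have := mul_le_mul_of_nonneg_right ht4 hC
      linarith
    have h4 := mul_le_mul_of_nonneg_left h2 hκ.le
    have h5 := mul_le_mul_of_nonneg_left h3 (sq_nonneg κ)
    have h6 : κ ^ 2 * (F ^ 4 * C) ≤ κ * (F ^ 4 * C) :=
      mul_le_mul_of_nonneg_right (by nlinarith) hY
    linarith
  have : 0 ≤ w ^ 4 * κ ^ 2 * h *
      ((1 - 2 * (κ * t)) * Q + κ * (t ^ 2 * L) + κ ^ 2 * (t ^ 4 * c) - m / 2) := by positivity
  have e3 : w ^ 4 * (κ * t) = w ^ 3 := by linear_combination w ^ 3 * hws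
  have e2 : w ^ 4 * (κ * t) ^ 2 = w ^ 2 := by
    linear_combination w ^ 2 * (w * (κ * t) + 1) * hws
  have e4 : w ^ 4 * (κ * t) ^ 4 = 1 := by rw [← mul_pow, hws, one_pow]
  refine sub_nonneg.1 (this.trans_eq ?_)
  linear_combination (-2 * κ ^ 2 * h * Q) * e3 + (κ * h * L) * e2 + h * c * e4

/-- Finitely many neighbourhoods suffice, and the minimum of their constants works. Used for the
ellipticity constant, where no continuity of the coefficients is available. -/
lemma _root_.IsCompact.exists_pos_forall_of_eventually {X : Type*} [TopologicalSpace X]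
    {U K : Set X} (hK : IsCompact K) (hKU : K ⊆ U) {P : ℝ → X → Prop}
    (hP : ∀ ε ε' x, ε' ≤ ε → P ε x → P ε' x)
    (h : ∀ p ∈ U, ∃ ε : ℝ, 0 < ε ∧ ∀ᶠ x in 𝓝[U] p, P ε x) :
    ∃ ε : ℝ, 0 < ε ∧ ∀ x ∈ K, P ε x := by
  refine hK.induction_on (p := fun s => ∃ ε : ℝ, 0 < ε ∧ ∀ x ∈ s, P ε x)
    ⟨1, one_pos, by simp⟩ ?_ ?_ ?_
  · rintro s t hst ⟨C, h0, h⟩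
    exact ⟨C, h0, fun x hx => h x (hst hx)⟩
  · rintro s t ⟨C, h0, h⟩ ⟨C', h0', h'⟩
    exact ⟨min C C', lt_min h0 h0', fun x hx => hx.elim
      (fun hx => hP _ _ _ (min_le_left _ _) (h x hx))
      fun hx => hP _ _ _ (min_le_right _ _) (h' x hx)⟩
  · intro x hx
    obtain ⟨C, h0, hC⟩ := h x (hKU hx)
    exact ⟨_, nhdsWithin_mono x hKU hC, C, h0, fun y hy => hy⟩

section bump

open Metric

variable {n : ℕ} {f : EuclideanSpace ℝ (Fin n) → ℝ}

lemma pderiv_expNegInvGlue (hf : ContDiff ℝ ∞ f) (κ : ℝ) (i : Fin n)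
    (y : EuclideanSpace ℝ (Fin n)) :
    pderiv i (fun y => expNegInvGlue (κ * f y)) y =
      (κ * f y)⁻¹ ^ 2 * expNegInvGlue (κ * f y) * (κ * pderiv i f y) := by
  have hd : Differentiable ℝ f := hf.differentiable (by simp)
  rw [pderiv_comp (f := fun y => κ * f y) (hasDerivAt_expNegInvGlue _) ((hd y).const_mul κ),
    pderiv_const_mul (hd y)]

lemma pderiv_pderiv_expNegInvGlue (hf : ContDiff ℝ ∞ f) (κ : ℝ) (i j : Fin n)
    (y : EuclideanSpace ℝ (Fin n)) :
    pderiv i (pderiv j (fun y => expNegInvGlue (κ * f y))) y =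
      ((κ * f y)⁻¹ ^ 4 - 2 * (κ * f y)⁻¹ ^ 3) * expNegInvGlue (κ * f y) * κ ^ 2 *
        (pderiv i f y * pderiv j f y) +
      (κ * f y)⁻¹ ^ 2 * expNegInvGlue (κ * f y) * κ * pderiv i (pderiv j f) y := by
  have hd : Differentiable ℝ f := hf.differentiable (by simp)
  have hd' : Differentiable ℝ (pderiv j f) :=
    (contDiff_pderiv hf (k := 1) one_add_one_le_infty j).differentiable (by simp)
  have hc := hasDerivAt_inv_sq_mul_expNegInvGlue (κ * f y)
  have hdc : DifferentiableAt ℝ (fun y => (κ * f y)⁻¹ ^ 2 * expNegInvGlue (κ * f y)) y :=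
    DifferentiableAt.comp (f := fun y => κ * f y) y hc.differentiableAt ((hd y).const_mul κ)
  rw [funext (pderiv_expNegInvGlue hf κ j), pderiv_mul hdc ((hd' y).const_mul κ),
    pderiv_const_mul (hd' y), pderiv_comp (f := fun y => κ * f y) hc ((hd y).const_mul κ),
    pderiv_const_mul (hd y)]
  ring

variable {M : Type*} [TopologicalSpace M]

lemma isCompact_preimage_closedBall {e : OpenPartialHomeomorph M (EuclideanSpace ℝ (Fin n))}
    {z : EuclideanSpace ℝ (Fin n)} {R : ℝ} (hR : closedBall z R ⊆ e.target) :
    IsCompact (e.source ∩ e ⁻¹' closedBall z R) := by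
  rw [← e.symm_image_eq_source_inter_preimage hR]
  exact (isCompact_closedBall z R).image_of_continuousOn (e.continuousOn_symm.mono hR)

variable [T2Space M] [ChartedSpace (EuclideanSpace ℝ (Fin n)) M]

/-- Extension by zero of a smooth function given in a chart. -/
lemma contMDiff_indicator_chart [IsManifold (𝓡 n) ∞ M]
    {e : OpenPartialHomeomorph M (EuclideanSpace ℝ (Fin n))}
    (he : e ∈ IsManifold.maximalAtlas (𝓡 n) ∞ M) {z : EuclideanSpace ℝ (Fin n)} {R : ℝ}
    (hR : closedBall z R ⊆ e.target) {u : EuclideanSpace ℝ (Fin n) → ℝ} (hu : ContDiff ℝ ∞ u)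
    (hsupp : ∀ y ∉ ball z R, u y = 0) :
    ContMDiff (𝓡 n) 𝓘(ℝ, ℝ) ∞ (e.source.indicator (u ∘ e)) := by
  refine contMDiff_of_tsupport fun x hx => ?_
  have hx' : x ∈ e.source ∩ e ⁻¹' closedBall z R := by
    refine closure_minimal (fun y hy => ?_) (isCompact_preimage_closedBall hR).isClosed hx
    rw [Function.mem_support, Set.indicator_apply_ne_zero] at hy
    refine ⟨hy.1, ball_subset_closedBall ?_⟩
    by_contra h
    exact hy.2 (hsupp _ h)
  have hux : ContMDiffAt (𝓡 n) 𝓘(ℝ, ℝ) ∞ (u ∘ e) x :=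
    hu.contMDiff.contMDiffAt.comp x
      ((contMDiffOn_of_mem_maximalAtlas he).contMDiffAt (e.open_source.mem_nhds hx'.1))
  refine hux.congr_of_eventuallyEq ?_
  filter_upwards [e.open_source.mem_nhds hx'.1] with y hy
  exact Set.indicator_of_mem hy _

set_option maxHeartbeats 800000 in
/-- In a coordinate ball there is a nonnegative bump function, positive exactly on the ball, to
which the operator gives nonnegative values outside a given neighbourhood of a given point of the
ball, and values bounded away from zero on the rest of each compact subset of the ball. -/
lemma IsLocallyUniformlyElliptic.exists_bump [IsManifold (𝓡 n) ∞ M] {A : (M → ℝ) → (M → ℝ)}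
    (hA : IsLocallyUniformlyElliptic (n := n) A)
    {e : OpenPartialHomeomorph M (EuclideanSpace ℝ (Fin n))}
    (he : e ∈ IsManifold.maximalAtlas (𝓡 n) ∞ M) {z : EuclideanSpace ℝ (Fin n)} {R : ℝ}
    (hR : closedBall z R ⊆ e.target) {p : M} (hp : p ∈ e.source ∩ e ⁻¹' ball z R)
    {U : Set M} (hU : IsOpen U) (hpU : p ∈ U) :
    ∃ α : M → ℝ, ContMDiff (𝓡 n) 𝓘(ℝ, ℝ) ∞ α ∧ (∀ x, 0 ≤ α x) ∧
      Function.support α = e.source ∩ e ⁻¹' ball z R ∧ (∀ x ∉ U, 0 ≤ A α x) ∧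
      ∀ K ⊆ e.source ∩ e ⁻¹' ball z R, IsCompact K → ∃ ε : ℝ, 0 < ε ∧ ∀ x ∈ K \ U, ε ≤ A α x := by
  obtain ⟨f, hf, hfpos, hfcrit⟩ := exists_contDiff_pos_iff_mem_ball hp.2
  obtain ⟨a, b, c, ha, hb, hc, hsymm, hell, hform⟩ := hA e he
  set K₀ : Set M := e.source ∩ e ⁻¹' closedBall z R with hK₀
  have hK₀c : IsCompact K₀ := isCompact_preimage_closedBall hR
  have hK₀s : K₀ ⊆ e.source := Set.inter_subset_left
  have h₁ : ∀ j, Continuous (pderiv j f) := fun j =>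
    (contDiff_pderiv hf (k := 1) one_add_one_le_infty j).continuous
  have h₂ : ∀ i j, Continuous (pderiv i (pderiv j f)) := fun i j =>
    (contDiff_pderiv (contDiff_pderiv hf (k := 1) one_add_one_le_infty j) (k := 0)
      (by norm_num) i).continuous
  have hcont : ∀ {g : EuclideanSpace ℝ (Fin n) → ℝ}, Continuous g →
      ContinuousOn (fun x => g (e x)) e.source := fun hg =>
    continuousOn_comp_chart fun y _ => hg.continuousAt
  obtain ⟨C₁, hC₁, hL⟩ := LocallyBoundedOn.exists_bound (U := e.source) (.add
      (.sum Finset.univ fun i => .sum Finset.univ fun j => (ha i j).mul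
        (hcont (h₂ i j)).locallyBoundedOn)
      (.sum Finset.univ fun i => (hb i).mul (hcont (h₁ i)).locallyBoundedOn)) hK₀c hK₀s
  obtain ⟨C₂, hC₂, hcb⟩ := hc.exists_bound hK₀c hK₀s
  obtain ⟨F, hF, hfF⟩ := (hcont hf.continuous).locallyBoundedOn.exists_bound hK₀c hK₀s
  obtain ⟨δ, hδ, hδa⟩ := hK₀c.exists_pos_forall_of_eventually hK₀s
    (P := fun δ x => ∀ μ : ℝ, Module.End.HasEigenvalue (Matrix.toLin' (a x)) μ → δ ≤ μ)
    (fun ε ε' x h h' μ hμ => h.trans (h' μ hμ)) hell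
  -- The only critical point of `f` in the closed ball corresponds to `p`, which lies in `U`; so the
  -- gradient has a positive minimum on the compact set `K₀ \ U`.
  obtain ⟨m₀, hm₀, hgrad⟩ := (hK₀c.diff hU).exists_forall_le' (a := 0)
    (f := fun x => ∑ i, pderiv i f (e x) ^ 2)
    ((hcont (continuous_finsetSum _ fun i _ => (h₁ i).pow 2)).mono
      (Set.sdiff_subset.trans hK₀s)) (by
      intro x hx
      by_contra! hle
      have h0 : ∀ i, pderiv i f (e x) = 0 := fun i => by
        have := (Finset.sum_eq_zero_iff_of_nonneg fun i _ => sq_nonneg (pderiv i f (e x))).1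
          (le_antisymm hle (Finset.sum_nonneg fun i _ => sq_nonneg _)) i (Finset.mem_univ i)
        exact pow_eq_zero_iff two_ne_zero |>.1 this
      have hfd : fderiv ℝ f (e x) = 0 := by
        have : (fderiv ℝ f (e x)).toLinearMap = 0 :=
          (EuclideanSpace.basisFun (Fin n) ℝ).toBasis.ext fun i => by
            simpa [pderiv] using h0 i
        ext v
        exact congrArg (fun T : _ →ₗ[ℝ] ℝ => T v) this
      have := e.injOn hx.1.1 hp.1 (hfcrit _ hx.1.2 hfd)
      exact hx.2 (this ▸ hpU))
  set m := δ * m₀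
  have hm : 0 < m := mul_pos hδ hm₀
  set C := max C₁ C₂
  have hC : 0 ≤ C := le_max_of_le_left hC₁
  set T := 2 * F * m + F ^ 2 * C + F ^ 4 * C
  have hT : 0 ≤ T := by positivity
  -- The denominator is `T + 1` because `T` may vanish.
  set κ : ℝ := min 1 (m / 2 / (T + 1))
  have hκ : 0 < κ := lt_min one_pos (by positivity)
  have hκT : κ * T ≤ m / 2 := by
    calc κ * T ≤ m / 2 / (T + 1) * (T + 1) :=
          mul_le_mul (min_le_right _ _) (by linarith) hT (by positivity)
      _ = m / 2 := by field_simp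
  set u : EuclideanSpace ℝ (Fin n) → ℝ := fun y => expNegInvGlue (κ * f y)
  have hu : ContDiff ℝ ∞ u := expNegInvGlue.contDiff.comp (contDiff_const.mul hf)
  have hfnp : ∀ y ∉ ball z R, f y ≤ 0 := fun y hy => not_lt.1 fun h => hy ((hfpos y).1 h)
  have hu0 : ∀ y ∉ ball z R, u y = 0 := fun y hy =>
    expNegInvGlue.zero_of_nonpos (mul_nonpos_of_nonneg_of_nonpos hκ.le (hfnp y hy))
  have hupos : ∀ y ∈ ball z R, 0 < u y := fun y hy =>
    expNegInvGlue.pos_of_pos (mul_pos hκ ((hfpos y).2 hy))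
  set α : M → ℝ := e.source.indicator (u ∘ e)
  have hα : ContMDiff (𝓡 n) 𝓘(ℝ, ℝ) ∞ α := contMDiff_indicator_chart he hR hu hu0
  have hα2 : ContMDiff (𝓡 n) 𝓘(ℝ, ℝ) 2 α := hα.of_le two_le_infty
  have hfnn : ∀ x ∈ K₀, 0 ≤ f (e x) := by
    intro x hx
    have : closure (ball z R) ⊆ {y | 0 ≤ f y} :=
      closure_minimal (fun y hy => ((hfpos y).2 hy).le) (isClosed_le continuous_const hf.continuous)
    have hRne : R ≠ 0 := (pos_of_mem_ball hp.2).ne'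
    rw [closure_ball z hRne] at this
    exact this hx.2
  have hlow : ∀ x ∈ K₀ \ U, κ ^ 2 * (m / 2) *
      ((κ * f (e x))⁻¹ ^ 4 * expNegInvGlue (κ * f (e x))) ≤ A α x := by
    intro x hx
    have hxs := hx.1.1
    have hsym : α ∘ e.symm =ᶠ[𝓝 (e x)] u := by
      filter_upwards [e.open_target.mem_nhds (e.map_source hxs)] with y hy
      simp [α, Set.indicator_of_mem (e.map_target hy), e.right_inv hy]
    have hαx : α x = u (e x) := Set.indicator_of_mem hxs _
    have hQ : m ≤ ∑ i, ∑ j, a x i j * (pderiv i f (e x) * pderiv j f (e x)) :=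
      (mul_le_mul_of_nonneg_left (hgrad x hx) hδ.le).trans
        (mul_sum_sq_le_of_eigenvalues (hsymm x hxs) (hδa x hx.1) fun i => pderiv i f (e x))
    refine (convexified_lower_bound hκ (min_le_left _ _) hF hm hC hκT (hfnn x hx.1)
      ((le_abs_self _).trans (hfF x hx.1)) hQ ((hL x hx.1).trans (le_max_left _ _))
      ((hcb x hx.1).trans (le_max_right _ _))).trans_eq ?_
    rw [hform α hα2 x hxs, hαx]
    simp only [(pderiv_congr hsym _).self_of_nhds,
      fun i j => (pderiv_congr (pderiv_congr hsym j) i).self_of_nhds, u,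
      pderiv_pderiv_expNegInvGlue hf, pderiv_expNegInvGlue hf]
    simp only [mul_add, Finset.mul_sum, Finset.sum_add_distrib]
    rw [← add_assoc]
    congr 1
    congr 1
    · congr 1
      · exact Finset.sum_congr rfl fun i _ => Finset.sum_congr rfl fun j _ => by ring
      · exact Finset.sum_congr rfl fun i _ => Finset.sum_congr rfl fun j _ => by ring
    · exact Finset.sum_congr rfl fun i _ => by ring
  have hsupp : Function.support α = e.source ∩ e ⁻¹' ball z R := by
    ext x
    rw [Function.mem_support, Set.indicator_apply_ne_zero]
    refine and_congr_right fun hx => ⟨fun h => ?_, fun h => (hupos _ h).ne'⟩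
    by_contra h'
    exact h (hu0 _ h')
  refine ⟨α, hα, fun x => Set.indicator_nonneg (fun y _ => expNegInvGlue.nonneg _) x, hsupp,
    fun x hx => ?_, fun K hKB hK => ?_⟩
  · by_cases hxK : x ∈ K₀
    · refine le_trans ?_ (hlow x ⟨hxK, hx⟩)
      exact mul_nonneg (by positivity)
        (mul_nonneg (Even.pow_nonneg (by decide) _) (expNegInvGlue.nonneg _))
    -- Zero is written as a product so that homogeneity of `A` yields the value `0`.
    · have h0 : α =ᶠ[𝓝 x] fun _ => 0 * (0 : ℝ) := by
        filter_upwards [hK₀c.isClosed.isOpen_compl.mem_nhds hxK] with y hy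
        rw [zero_mul]
        by_contra h
        have : y ∈ Function.support α := h
        rw [hsupp] at this
        exact hy ⟨this.1, ball_subset_closedBall this.2⟩
      rw [hA.congr_of_eventuallyEq hα2 contMDiff_const h0,
        hA.map_const_mul (φ := fun _ => 0) contMDiff_const 0 x, zero_mul]
  · have hKK : K ⊆ K₀ := fun x hx => ⟨(hKB hx).1, ball_subset_closedBall (hKB hx).2⟩
    obtain ⟨ε, hε, h⟩ := hK.exists_forall_le' (a := 0)
      (f := fun x => κ ^ 2 * (m / 2) * ((κ * f (e x))⁻¹ ^ 4 * expNegInvGlue (κ * f (e x))))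
      ((hcont (continuous_const.mul ((continuous_inv_pow_mul_expNegInvGlue 4).comp
        (continuous_const.mul hf.continuous)))).mono (hKK.trans hK₀s)) (by
        intro x hx
        have h1 : 0 < κ * f (e x) := mul_pos hκ ((hfpos _).2 (hKB hx).2)
        have h2 := expNegInvGlue.pos_of_pos h1
        positivity)
    exact ⟨ε, hε, fun x hx => (h x hx.1).trans (hlow x ⟨hKK hx.1, hx.2⟩)⟩

end bump

/-! ### Successors in a cover and the compensation estimate -/

/-- In a connected noncompact space, the members of a locally finite cover by nonempty relatively
compact open sets can be joined to infinity: each set meets a chosen successor, and tracing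
successors backwards always stops. -/
lemma exists_successor_of_cover {X ι : Type*} [TopologicalSpace X] [ConnectedSpace X]
    [NoncompactSpace X] {B : ι → Set X} (hopen : ∀ i, IsOpen (B i)) (hne : ∀ i, (B i).Nonempty)
    (hcomp : ∀ i, IsCompact (closure (B i))) (hlf : LocallyFinite B) (hcov : ⋃ i, B i = Set.univ) :
    ∃ s : ι → ι, (∀ i, i ≠ s i ∧ (B i ∩ B (s i)).Nonempty) ∧
      (WellFounded fun w v => s w = v) ∧ ∀ v, {w | s w = v}.Finite := by
  have hfin : ∀ i, {j | (B i ∩ B j).Nonempty}.Finite := fun i =>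
    (hlf.finite_nonempty_inter_compact (hcomp i)).subset fun j hj => by
      obtain ⟨x, hi, hj⟩ := hj
      exact ⟨x, hj, subset_closure hi⟩
  have hinf : Infinite ι := by
    by_contra h
    have := not_infinite_iff_finite.1 h
    have hc := isCompact_iUnion hcomp
    have : (⋃ i, closure (B i)) = Set.univ :=
      Set.univ_subset_iff.1 (hcov ▸ Set.iUnion_mono fun i => subset_closure)
    rw [this] at hc
    exact noncompact_univ X hc
  -- The nerve of the cover. It is locally finite by local finiteness and relative compactness, and
  -- infinite because finitely many relatively compact sets cannot cover a noncompact space.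
  let G : SimpleGraph ι := SimpleGraph.fromRel fun i j => (B i ∩ B j).Nonempty
  have hadj : ∀ i j, G.Adj i j ↔ i ≠ j ∧ (B i ∩ B j).Nonempty := fun i j => by
    rw [SimpleGraph.fromRel_adj, Set.inter_comm (B j), or_self]
  have hG : G.Connected := by
    refine SimpleGraph.connected_iff_exists_forall_reachable G |>.2 ?_
    obtain ⟨r⟩ : Nonempty ι := inferInstance
    refine ⟨r, fun i => ?_⟩
    have hstep : ∀ i j, G.Reachable r j → (B i ∩ B j).Nonempty → G.Reachable r i := by
      intro i j hj hij
      by_cases h : j = i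
      · exact h ▸ hj
      · exact hj.trans ((hadj j i).2 ⟨h, Set.inter_comm (B i) _ ▸ hij⟩).reachable
    -- No member outside the component of `r` meets one inside it, so the two unions are
    -- complementary open sets.
    have hclopen : IsClopen (⋃ j ∈ {j | G.Reachable r j}, B j) := by
      refine ⟨⟨?_⟩, isOpen_biUnion fun j _ => hopen j⟩
      have : (⋃ j ∈ {j | G.Reachable r j}, B j)ᶜ = ⋃ j ∈ {j | ¬ G.Reachable r j}, B j := by
        ext x
        simp only [Set.mem_compl_iff, Set.mem_iUnion, Set.mem_ofPred_eq, not_exists]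
        constructor
        · intro h
          obtain ⟨j, hj⟩ := Set.mem_iUnion.1 (hcov ▸ Set.mem_univ x)
          exact ⟨j, fun hr => h j hr hj, hj⟩
        · rintro ⟨j, hr, hj⟩ k hk hxk
          exact hr (hstep j k hk ⟨x, hj, hxk⟩)
      rw [this]
      exact isOpen_biUnion fun j _ => hopen j
    obtain ⟨y, hy⟩ := hne r
    have huniv := hclopen.eq_univ ⟨y, Set.mem_biUnion (SimpleGraph.Reachable.refl r) hy⟩
    obtain ⟨x, hx⟩ := hne i
    have hxU := huniv ▸ Set.mem_univ x
    simp only [Set.mem_iUnion] at hxU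
    obtain ⟨j, hj, hxj⟩ := hxU
    exact hstep i j hj ⟨x, hx, hxj⟩
  obtain ⟨s, hs, hwf⟩ := exists_adj_wellFounded hG fun i =>
    (hfin i).subset fun j hj => ((hadj i j).1 hj).2
  refine ⟨s, fun i => (hadj _ _).1 (hs i), hwf, fun v => (hfin v).subset fun w hw => ?_⟩
  have := ((hadj _ _).1 (hs w)).2
  rw [show s w = v from hw, Set.inter_comm] at this
  exact this

/-- The estimate behind the choice of the coefficients: at a fixed point the negative terms of a
finite sum, indexed by `i` with `bad i`, are compensated by the terms of their successors. -/
lemma lt_sum_of_successor {ι : Type*} (I : Finset ι) (s : ι → ι) {C a D ε : ι → ℝ} {ρ : ℝ}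
    (bad : ι → Prop) (hfib : ∀ v, {w | s w = v}.Finite) (hC : ∀ i, 0 ≤ C i) (hD : ∀ i, 0 ≤ D i)
    (hρ : 0 < ρ) (hgood : ∀ i, ¬ bad i → 0 ≤ a i) (hbad : ∀ i, bad i → -D i ≤ a i)
    (hsI : ∀ i, bad i → s i ∈ I) (hsbad : ∀ i, bad i → ¬ bad (s i))
    (hsε : ∀ i, bad i → ε (s i) ≤ a (s i))
    (hsC : ∀ i, bad i → ρ + ∑ w ∈ (hfib (s i)).toFinset, C w * D w < C (s i) * ε (s i))
    (hone : (∀ i, ¬ bad i) → ∃ v ∈ I, ρ < C v * a v) :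
    ρ < ∑ i ∈ I, C i * a i := by
  classical
  by_cases hex : ∃ i ∈ I, bad i
  · obtain ⟨i₀, hi₀, hb₀⟩ := hex
    set W := I.filter bad with hW
    set S := W.image s
    have hSI : S ⊆ I.filter fun i => ¬ bad i := by
      intro v hv
      obtain ⟨w, hw, rfl⟩ := Finset.mem_image.1 hv
      have hwb := (Finset.mem_filter.1 hw).2
      exact Finset.mem_filter.2 ⟨hsI w hwb, hsbad w hwb⟩
    have h1 : -∑ w ∈ W, C w * D w ≤ ∑ w ∈ W, C w * a w := by
      rw [← Finset.sum_neg_distrib]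
      refine Finset.sum_le_sum fun w hw => ?_
      have := mul_le_mul_of_nonneg_left (hbad w (Finset.mem_filter.1 hw).2) (hC w)
      linarith
    have h2 : ∑ v ∈ S, C v * a v ≤ ∑ v ∈ I.filter (fun i => ¬ bad i), C v * a v :=
      Finset.sum_le_sum_of_subset_of_nonneg hSI fun v hv _ =>
        mul_nonneg (hC v) (hgood v (Finset.mem_filter.1 hv).2)
    -- Several bad terms may share a successor, so they are grouped by it; the coefficient of the
    -- successor pays for its whole fibre.
    have h3 : ∑ w ∈ W, C w * D w = ∑ v ∈ S, ∑ w ∈ W.filter (fun w => s w = v), C w * D w :=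
      (Finset.sum_fiberwise_of_maps_to (fun w hw => Finset.mem_image_of_mem s hw) _).symm
    have h4 : ∀ v ∈ S, ρ ≤ C v * a v - ∑ w ∈ W.filter (fun w => s w = v), C w * D w ∧
        ρ < C v * a v - ∑ w ∈ W.filter (fun w => s w = v), C w * D w := by
      intro v hv
      obtain ⟨i, hi, rfl⟩ := Finset.mem_image.1 hv
      have hib := (Finset.mem_filter.1 hi).2
      have h5 : ∑ w ∈ W.filter (fun w => s w = s i), C w * D w ≤
          ∑ w ∈ (hfib (s i)).toFinset, C w * D w :=
        Finset.sum_le_sum_of_subset_of_nonneg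
          (fun w hw => (hfib _).mem_toFinset.2 (Finset.mem_filter.1 hw).2)
          fun w _ _ => mul_nonneg (hC w) (hD w)
      have h6 := mul_le_mul_of_nonneg_left (hsε i hib) (hC (s i))
      have h7 := hsC i hib
      constructor <;> linarith
    have hi₀S : s i₀ ∈ S := Finset.mem_image_of_mem s (Finset.mem_filter.2 ⟨hi₀, hb₀⟩)
    have h5 := Finset.single_le_sum
      (f := fun v => C v * a v - ∑ w ∈ W.filter (fun w => s w = v), C w * D w)
      (fun v hv => hρ.le.trans (h4 v hv).1) hi₀S
    have h6 := (h4 _ hi₀S).2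
    rw [Finset.sum_sub_distrib, ← h3] at h5
    rw [← Finset.sum_filter_add_sum_filter_not I bad]
    linarith
  · push Not at hex
    by_cases hall : ∀ i, ¬ bad i
    · obtain ⟨v, hv, hρv⟩ := hone hall
      exact hρv.trans_le (Finset.single_le_sum (f := fun i => C i * a i)
        (fun i _ => mul_nonneg (hC i) (hgood i (hall i))) hv)
    -- Here the only bad indices lie outside `I`; the successor of one of them still lies in `I`,
    -- and its term alone exceeds `ρ`.
    · push Not at hall
      obtain ⟨i, hi⟩ := hall
      have h6 := mul_le_mul_of_nonneg_left (hsε i hi) (hC (s i))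
      have h7 := hsC i hi
      have h8 : 0 ≤ ∑ w ∈ (hfib (s i)).toFinset, C w * D w :=
        Finset.sum_nonneg fun w _ => mul_nonneg (hC w) (hD w)
      have h9 := Finset.single_le_sum (f := fun i => C i * a i)
        (fun j hj => mul_nonneg (hC j) (hgood j (hex j hj))) (hsI i hi)
      linarith

/-- Separate each `q i` from `q (s i)` and shrink. Each point meets only finitely many such
conditions because the fibres of `s` are finite. -/
lemma exists_disjoint_compact_nhds {X ι : Type*} [TopologicalSpace X] [T2Space X]
    [LocallyCompactSpace X] {s : ι → ι} (hfib : ∀ v, {w | s w = v}.Finite) {q : ι → X}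
    (hq : ∀ i, q i ≠ q (s i)) {O : ι → Set X} (hO : ∀ i, IsOpen (O i)) (hqO : ∀ i, q i ∈ O i) :
    ∃ N : ι → Set X, (∀ i, IsCompact (N i)) ∧ (∀ i, q i ∈ interior (N i)) ∧
      (∀ i, N i ⊆ O i) ∧ ∀ i, Disjoint (N i) (N (s i)) := by
  choose V V' hV hV' hqV hqV' hd using fun i => t2_separation (hq i)
  have : ∀ i, ∃ N, IsCompact N ∧ q i ∈ interior N ∧
      N ⊆ O i ∩ (V i ∩ ⋂ w ∈ {w | s w = i}, V' w) := fun i => by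
    refine exists_compact_subset ((hO i).inter ((hV i).inter
      ((hfib i).isOpen_biInter fun w _ => hV' w))) ⟨hqO i, hqV i, ?_⟩
    simp only [Set.mem_iInter]
    rintro w rfl
    exact hqV' w
  choose N hN hqN hsub using this
  refine ⟨N, hN, hqN, fun i => (hsub i).trans Set.inter_subset_left, fun i => ?_⟩
  refine (hd i).mono (fun x hx => (hsub i hx).2.1) fun x hx => ?_
  have := (hsub _ hx).2.2
  simp only [Set.mem_iInter] at this
  exact this i rfl

/-! ### Construction of the function in part (1) -/

section

open Metric

universe u

variable {n : ℕ} {M : Type u} [TopologicalSpace M] [T2Space M] [SecondCountableTopology M]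
  [ChartedSpace (EuclideanSpace ℝ (Fin n)) M] [IsManifold (𝓡 n) ∞ M]

/-- A locally finite cover by coordinate balls, together with a compact refinement. -/
lemma exists_locallyFinite_coordinate_balls :
    ∃ (ι : Type u) (e : ι → OpenPartialHomeomorph M (EuclideanSpace ℝ (Fin n)))
      (z : ι → EuclideanSpace ℝ (Fin n)) (R : ι → ℝ) (B K : ι → Set M),
      (∀ i, B i = (e i).source ∩ e i ⁻¹' ball (z i) (R i)) ∧
      (∀ i, e i ∈ IsManifold.maximalAtlas (𝓡 n) ∞ M) ∧
      (∀ i, closedBall (z i) (R i) ⊆ (e i).target) ∧ (∀ i, (B i).Nonempty) ∧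
      (∀ i, IsOpen (B i)) ∧ (∀ i, IsCompact (closure (B i))) ∧ LocallyFinite B ∧
      (∀ i, IsCompact (K i)) ∧ (∀ i, K i ⊆ B i) ∧ (∀ x, ∃ i, x ∈ K i) ∧ Countable ι := by
  have : LocallyCompactSpace M := ChartedSpace.locallyCompactSpace (EuclideanSpace ℝ (Fin n)) M
  obtain ⟨ι, fs, -⟩ := SmoothBumpCovering.exists_isSubordinate (𝓡 n) (M := M) (s := Set.univ)
    (U := fun _ => Set.univ) isClosed_univ (fun _ _ => Filter.univ_mem)
  -- The balls are the supports of a smooth bump covering, and the compact refinement consists of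
  -- the sets where the bumps equal `1`.
  refine ⟨ι, fun i => chartAt _ (fs.c i), fun i => chartAt _ (fs.c i) (fs.c i),
    fun i => (fs i).rOut, fun i => Function.support (fs i), fun i => fs i ⁻¹' {1},
    fun i => ?_, fun i => ?_, fun i => ?_, fun i => (fs i).nonempty_support,
    fun i => (fs i).isOpen_support, fun i => (fs i).hasCompactSupport, fs.locallyFinite,
    fun i => ?_, fun i x hx => ?_, fun x => ?_, ?_⟩
  · simpa using (fs i).support_eq_inter_preimage
  · exact IsManifold.chart_mem_maximalAtlas _
  · simpa using (fs i).closedBall_subset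
  · refine (fs i).hasCompactSupport.of_isClosed_subset
      (isClosed_singleton.preimage (fs i).continuous) fun x hx => subset_closure ?_
    rw [Function.mem_support, show fs i x = 1 from hx]
    exact one_ne_zero
  · rw [Function.mem_support, show fs i x = 1 from hx]
    exact one_ne_zero
  · exact ⟨_, fs.apply_ind x (Set.mem_univ x)⟩
  · have := fs.locallyFinite.countable_univ fun i => (fs i).nonempty_support
    exact Set.countable_univ_iff.1 this

variable [ConnectedSpace M] [NoncompactSpace M]

theorem IsLocallyUniformlyElliptic.exists_contMDiff_lt {A : (M → ℝ) → (M → ℝ)}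
    (hA : IsLocallyUniformlyElliptic (n := n) A) {ρ : M → ℝ} (hρ : Continuous ρ)
    (hρ0 : ∀ x, 0 < ρ x) :
    ∃ φ : M → ℝ, ContMDiff (𝓡 n) 𝓘(ℝ, ℝ) ∞ φ ∧ (∀ x, ρ x < φ x) ∧ (∀ x, ρ x < A φ x) := by
  have : LocallyCompactSpace M := ChartedSpace.locallyCompactSpace (EuclideanSpace ℝ (Fin n)) M
  have : Nontrivial M := by
    by_contra h
    rw [not_nontrivial_iff_subsingleton] at h
    exact noncompact_univ M Set.subsingleton_univ.isCompact
  obtain ⟨ι, e, z, R, B, K, hB, he, hR, hBne, hBo, hBc, hlf, hK, hKB, hcov, hcount⟩ :=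
    exists_locallyFinite_coordinate_balls (n := n) (M := M)
  obtain ⟨s, hs, hwf, hfib⟩ := exists_successor_of_cover hBo hBne hBc hlf
    (Set.eq_univ_of_forall fun x => Set.mem_iUnion.2 ((hcov x).imp fun i hi => hKB i hi))
  -- A connected Hausdorff space with more than one point has no isolated points.
  have hinf : ∀ i, (B i ∩ B (s i)).Infinite := fun i => by
    obtain ⟨x, hx⟩ := (hs i).2
    exact infinite_of_mem_nhds x (((hBo i).inter (hBo (s i))).mem_nhds hx)
  obtain ⟨q, hq, hqB⟩ := exists_injective_forall_mem hinf
  obtain ⟨N, hN, hqN, hNB, hNd⟩ := exists_disjoint_compact_nhds hfib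
    (fun i h => (hs i).1 (hq h)) (fun i => hBo (s i)) fun i => (hqB i).2
  choose α hα hα0 hαs hαA hαK using fun i => hA.exists_bump (he i) (hR i)
    (hB i ▸ (hqB i).1) isOpen_interior (hqN i)
  have hα2 : ∀ i, ContMDiff (𝓡 n) 𝓘(ℝ, ℝ) 2 (α i) := fun i => (hα i).of_le two_le_infty
  have hαB : ∀ i, Function.support (α i) = B i := fun i => (hαs i).trans (hB i).symm
  choose D hD0 hD using fun i =>
    (hA.locallyBoundedOn (hα2 i)).exists_bound (hN i) (Set.subset_univ _)
  -- The part of `B i` where `α i` must work: its share `K i` of the cover and the defect sets of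
  -- all predecessors of `i`.
  let Q : ι → Set M := fun i => K i ∪ ⋃ w ∈ {w | s w = i}, N w
  have hQ : ∀ i, IsCompact (Q i) := fun i =>
    (hK i).union ((hfib i).isCompact_biUnion fun w _ => hN w)
  have hQB : ∀ i, Q i ⊆ B i := fun i => Set.union_subset (hKB i) <|
    Set.iUnion₂_subset fun w hw => by
      rw [← show s w = i from hw]
      exact hNB w
  have hNQ : ∀ w, N w ⊆ Q (s w) := fun w x hx =>
    Or.inr (Set.mem_biUnion (show w ∈ {w' | s w' = s w} from rfl) hx)
  choose ε hε hεA using fun i => hαK i (Q i) (hB i ▸ hQB i) (hQ i)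
  choose η hη hηα using fun i => (hQ i).exists_forall_le' (a := 0) (hα i).continuous.continuousOn
    fun x hx => (hα0 i x).lt_of_ne' (by
      have := hQB i hx
      rwa [← hαB i] at this)
  choose P hP0 hP using fun i => LocallyBoundedOn.exists_bound
    (hρ.continuousOn (s := Set.univ)).locallyBoundedOn (hQ i) (Set.subset_univ _)
  -- The first summand makes `C i * ε i` exceed the bound for `ρ` plus the total defect of the
  -- predecessors; the second makes `C i * η i` exceed the bound for `ρ`, which gives `φ > ρ`.
  obtain ⟨C, hC⟩ := exists_coeff_of_wellFounded hwf hfib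
    (fun i t => (|t| + P i + 1) / ε i + (P i + 1) / η i) D
  have hC0 : ∀ i, 0 ≤ C i := fun i => by
    rw [hC i]
    have := hε i
    have := hη i
    have := hP0 i
    positivity
  have hCε : ∀ i, P i + ∑ w ∈ (hfib i).toFinset, C w * D w < C i * ε i := fun i => by
    have h1 : (|∑ w ∈ (hfib i).toFinset, C w * D w| + P i + 1) / ε i ≤ C i := by
      conv_rhs => rw [hC i]
      have := hη i
      have := hP0 i
      have : 0 ≤ (P i + 1) / η i := by positivity
      linarith
    rw [div_le_iff₀ (hε i)] at h1
    have := le_abs_self (∑ w ∈ (hfib i).toFinset, C w * D w)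
    linarith
  have hCη : ∀ i, P i < C i * η i := fun i => by
    have h1 : (P i + 1) / η i ≤ C i := by
      conv_rhs => rw [hC i]
      have := hε i
      have := hP0 i
      have : 0 ≤ (|∑ w ∈ (hfib i).toFinset, C w * D w| + P i + 1) / ε i := by positivity
      linarith
    rw [div_le_iff₀ (hη i)] at h1
    linarith
  have hρP : ∀ i, ∀ x ∈ Q i, ρ x ≤ P i := fun i x hx => (le_abs_self _).trans (hP i x hx)
  have hsub : ∀ i, (Function.support fun x => C i * α i x) ⊆ B i := fun i => by
    rw [← hαB i]
    exact Function.support_mul_subset_right _ _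
  set φ : M → ℝ := fun x => ∑ᶠ i, C i * α i x with hφdef
  have hφ : ContMDiff (𝓡 n) 𝓘(ℝ, ℝ) ∞ φ :=
    contMDiff_finsum (fun i => contMDiff_const_mul (hα i) (C i)) (hlf.subset hsub)
  have hloc : ∀ x, ∃ I : Finset ι, (∀ i, x ∈ B i → i ∈ I) ∧
      φ =ᶠ[𝓝 x] fun y => ∑ i ∈ I, C i * α i y := by
    intro x
    obtain ⟨t, ht, htf⟩ := hlf x
    refine ⟨htf.toFinset, fun i hi => htf.mem_toFinset.2 ⟨x, hi, mem_of_mem_nhds ht⟩, ?_⟩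
    filter_upwards [ht] with y hy
    refine finsum_eq_sum_of_support_subset _ fun i hi => ?_
    exact htf.mem_toFinset.2 ⟨y, hsub i hi, hy⟩
  refine ⟨φ, hφ, fun x => ?_, fun x => ?_⟩
  · obtain ⟨I, hI, hφI⟩ := hloc x
    obtain ⟨v, hv⟩ := hcov x
    have hvQ : x ∈ Q v := Or.inl hv
    rw [hφI.self_of_nhds]
    calc ρ x ≤ P v := hρP v x hvQ
      _ < C v * η v := hCη v
      _ ≤ C v * α v x := mul_le_mul_of_nonneg_left (hηα v x hvQ) (hC0 v)
      _ ≤ _ := Finset.single_le_sum (f := fun i => C i * α i x)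
        (fun i _ => mul_nonneg (hC0 i) (hα0 i x)) (hI v (hKB v hv))
  · obtain ⟨I, hI, hφI⟩ := hloc x
    have hsum : ContMDiff (𝓡 n) 𝓘(ℝ, ℝ) 2 fun y => ∑ i ∈ I, C i * α i y :=
      contMDiff_finsetSum fun i _ => contMDiff_const_mul (hα2 i) (C i)
    rw [hA.congr_of_eventuallyEq (hφ.of_le two_le_infty) hsum hφI, hA.map_sum I C hα2]
    have hdis : ∀ i, x ∈ interior (N i) → x ∉ interior (N (s i)) := fun i hi hi' =>
      Set.disjoint_left.1 (hNd i) (interior_subset hi) (interior_subset hi')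
    refine lt_sum_of_successor I s (D := D) (ε := ε) (fun i => x ∈ interior (N i)) hfib hC0 hD0
      (hρ0 x) (fun i hi => hαA i x hi) (fun i hi => ?_) (fun i hi => ?_) hdis (fun i hi => ?_)
      (fun i hi => ?_) fun hno => ?_
    · exact (abs_le.1 (hD i x (interior_subset hi))).1
    · exact hI _ (hNB i (interior_subset hi))
    · exact hεA (s i) x ⟨hNQ i (interior_subset hi), hdis i hi⟩
    · have := hρP (s i) x (hNQ i (interior_subset hi))
      have := hCε (s i)
      linarith
    · obtain ⟨v, hv⟩ := hcov x
      have hvQ : x ∈ Q v := Or.inl hv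
      refine ⟨v, hI v (hKB v hv), ?_⟩
      have h1 := mul_le_mul_of_nonneg_left (hεA v x ⟨hvQ, hno v⟩) (hC0 v)
      have h2 := hCε v
      have h3 := hρP v x hvQ
      have h4 : 0 ≤ ∑ w ∈ (hfib v).toFinset, C w * D w :=
        Finset.sum_nonneg fun w _ => mul_nonneg (hC0 w) (hD0 w)
      linarith

end

/-! ### Determinants, adjugates and Piola's identity -/

section matrixCalculus

open Matrix

variable {E : Type*} [NormedAddCommGroup E] [NormedSpace ℝ E] {m : Type*} [Fintype m]
  [DecidableEq m] {k : WithTop ℕ∞} {J : E → Matrix m m ℝ} {y : E}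

lemma contDiffAt_det (hJ : ∀ i j, ContDiffAt ℝ k (fun z => J z i j) y) :
    ContDiffAt ℝ k (fun z => (J z).det) y := by
  simp only [Matrix.det_apply]
  exact ContDiffAt.sum fun σ _ => (contDiffAt_prod fun i _ => hJ (σ i) i).const_smul _

lemma contDiffAt_adjugate (hJ : ∀ i j, ContDiffAt ℝ k (fun z => J z i j) y) (i j : m) :
    ContDiffAt ℝ k (fun z => (J z).adjugate i j) y := by
  simp only [Matrix.adjugate_apply]
  refine contDiffAt_det fun a b => ?_
  simp only [Matrix.updateRow_apply]
  split_ifs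
  · exact contDiffAt_const
  · exact hJ a b

lemma contDiffAt_inv (hJ : ∀ i j, ContDiffAt ℝ k (fun z => J z i j) y) (hdet : (J y).det ≠ 0)
    (i j : m) : ContDiffAt ℝ k (fun z => (J z)⁻¹ i j) y := by
  simp only [Matrix.inv_def, Ring.inverse_eq_inv', Matrix.smul_apply, smul_eq_mul]
  exact ((contDiffAt_det hJ).inv hdet).mul (contDiffAt_adjugate hJ i j)

end matrixCalculus

section piola

open Matrix

variable {n : ℕ} {y : EuclideanSpace ℝ (Fin n)}

lemma pderiv_sum {ι : Type*} {s : Finset ι} {f : ι → EuclideanSpace ℝ (Fin n) → ℝ}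
    (hf : ∀ k ∈ s, DifferentiableAt ℝ (f k) y) (i : Fin n) :
    pderiv i (fun z => ∑ k ∈ s, f k z) y = ∑ k ∈ s, pderiv i (f k) y := by
  simp only [pderiv, fderiv_fun_sum hf]
  rw [_root_.sum_apply]

lemma pderiv_prod {ι : Type*} [DecidableEq ι] {s : Finset ι}
    {f : ι → EuclideanSpace ℝ (Fin n) → ℝ} (hf : ∀ k ∈ s, DifferentiableAt ℝ (f k) y)
    (i : Fin n) : pderiv i (fun z => ∏ k ∈ s, f k z) y =
      ∑ k ∈ s, (∏ j ∈ s.erase k, f j y) * pderiv i (f k) y := by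
  have := (HasFDerivAt.finsetProd fun k hk => (hf k hk).hasFDerivAt).fderiv
  have h2 : fderiv ℝ (fun z => ∏ k ∈ s, f k z) y = _ := this
  simp only [pderiv, h2]
  rw [_root_.sum_apply]
  rfl

/-- Jacobi's formula for the derivative of a determinant. -/
lemma pderiv_det {m : Type*} [Fintype m] [DecidableEq m]
    {J : EuclideanSpace ℝ (Fin n) → Matrix m m ℝ}
    (hJ : ∀ a b, DifferentiableAt ℝ (fun z => J z a b) y) (i : Fin n) :
    pderiv i (fun z => (J z).det) y =
      ∑ a, ∑ b, (J y).adjugate a b * pderiv i (fun z => J z b a) y := by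
  have hrhs : ∀ a, ∑ b, (J y).adjugate a b * pderiv i (fun z => J z b a) y =
      ((J y).updateCol a fun b => pderiv i (fun z => J z b a) y).det := by
    intro a
    rw [← cramer_apply, cramer_eq_adjugate_mulVec]
    rfl
  simp only [hrhs, Matrix.det_apply']
  have hprod : ∀ σ : Equiv.Perm m, DifferentiableAt ℝ (fun z => ∏ c, J z (σ c) c) y := fun σ =>
    (HasFDerivAt.finsetProd fun c _ => (hJ (σ c) c).hasFDerivAt).differentiableAt
  rw [pderiv_sum fun σ _ => (hprod σ).const_mul _, Finset.sum_comm]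
  refine Finset.sum_congr rfl fun σ _ => ?_
  rw [pderiv_const_mul (hprod σ), pderiv_prod fun c _ => hJ (σ c) c, Finset.mul_sum]
  refine Finset.sum_congr rfl fun c _ => ?_
  rw [← Finset.mul_prod_erase Finset.univ _ (Finset.mem_univ c)]
  have : ∏ x ∈ Finset.univ.erase c,
      (J y).updateCol c (fun b => pderiv i (fun z => J z b c) y) (σ x) x =
      ∏ x ∈ Finset.univ.erase c, J y (σ x) x :=
    Finset.prod_congr rfl fun x hx => updateCol_ne (Finset.ne_of_mem_erase hx)
  rw [this, updateCol_self]
  ring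

/-- Piola's identity: the cofactors of a Jacobian matrix are divergence free. -/
lemma sum_pderiv_adjugate {J : EuclideanSpace ℝ (Fin n) → Matrix (Fin n) (Fin n) ℝ}
    (hJ : ∀ a b, ContDiffAt ℝ 1 (fun z => J z a b) y)
    (hsymm : ∀ i a b, pderiv i (fun z => J z b a) y = pderiv a (fun z => J z b i) y)
    (hdet : (J y).det ≠ 0) (k : Fin n) :
    ∑ i, pderiv i (fun z => (J z).adjugate i k) y = 0 := by
  have hd : ∀ a b, DifferentiableAt ℝ (fun z => J z a b) y := fun a b =>
    (hJ a b).differentiableAt (by simp)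
  have hda : ∀ a b, DifferentiableAt ℝ (fun z => (J z).adjugate a b) y := fun a b =>
    (contDiffAt_adjugate hJ a b).differentiableAt (by simp)
  have hdd : DifferentiableAt ℝ (fun z => (J z).det) y :=
    (contDiffAt_det hJ).differentiableAt (by simp)
  set P := (J y).adjugate with hP
  let H : Fin n → Matrix (Fin n) (Fin n) ℝ := fun i => of fun a b => pderiv i (fun z => J z a b) y
  let L : Fin n → Matrix (Fin n) (Fin n) ℝ := fun i =>
    of fun a b => pderiv i (fun z => (J z).adjugate a b) y
  have h1 : ∀ i, J y * L i + H i * P =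
      pderiv i (fun z => (J z).det) y • (1 : Matrix (Fin n) (Fin n) ℝ) := by
    intro i
    ext a b
    have h2 : (fun z => ∑ c, J z a c * (J z).adjugate c b) =
        fun z => (1 : Matrix (Fin n) (Fin n) ℝ) a b * (J z).det := by
      funext z
      have := congrFun (congrFun (mul_adjugate (J z)) a) b
      rw [mul_apply] at this
      rw [this, Matrix.smul_apply, smul_eq_mul, mul_comm]
    have h3 := congrArg (fun f => pderiv i f y) h2
    beta_reduce at h3
    rw [pderiv_sum fun c _ => (hd a c).fun_mul (hda c b), pderiv_const_mul hdd] at h3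
    simp only [fun c => pderiv_mul (hd a c) (hda c b) i, Finset.sum_add_distrib] at h3
    rw [Matrix.smul_apply, smul_eq_mul, mul_comm, ← h3, Matrix.add_apply, mul_apply, mul_apply]
    rfl
  -- Differentiate `J · adj J = det J · 1` and multiply by `adj J` on the left.
  have h2 : ∀ i, (J y).det • L i + P * H i * P = pderiv i (fun z => (J z).det) y • P := by
    intro i
    have := congrArg (fun X => P * X) (h1 i)
    simp only [mul_add, ← Matrix.mul_assoc, hP, adjugate_mul, Matrix.smul_mul, Matrix.one_mul,
      Matrix.mul_smul, Matrix.mul_one] at this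
    exact this
  have h3 : (J y).det * ∑ i, L i i k = 0 := by
    have h4 : ∀ i, (J y).det * L i i k =
        (∑ a, ∑ b, P a b * H i b a) * P i k - ∑ b, ∑ a, P i a * H i a b * P b k := by
      intro i
      have := congrFun (congrFun (h2 i) i) k
      rw [Matrix.add_apply, Matrix.smul_apply, Matrix.smul_apply, smul_eq_mul, smul_eq_mul,
        pderiv_det hd] at this
      rw [eq_sub_iff_add_eq]
      convert this using 2
      · simp only [mul_apply, Finset.sum_mul]
      · rfl
    rw [Finset.mul_sum, Finset.sum_congr rfl fun i _ => h4 i, Finset.sum_sub_distrib, sub_eq_zero]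
    -- Symmetry of second derivatives: after renaming indices the two triple sums coincide.
    have h5 : ∀ i a b, H i b a = H a b i := fun i a b => hsymm i a b
    simp only [Finset.sum_mul]
    rw [Finset.sum_comm]
    rw [Finset.sum_congr rfl fun a _ => Finset.sum_congr rfl fun i _ =>
      Finset.sum_congr rfl fun b _ => by rw [h5 i a b]]
  exact (mul_eq_zero.1 h3).resolve_left hdet

lemma pderiv_pderiv_comm {f : EuclideanSpace ℝ (Fin n) → ℝ} (hf : ContDiffAt ℝ 2 f y)
    (i j : Fin n) : pderiv i (pderiv j f) y = pderiv j (pderiv i f) y := by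
  have hs := hf.isSymmSndFDerivAt (by simp)
  have hd : DifferentiableAt ℝ (fderiv ℝ f) y :=
    (hf.fderiv_right (m := 1) (by norm_num)).differentiableAt (by simp)
  have h : ∀ a b : Fin n, pderiv a (pderiv b f) y =
      fderiv ℝ (fderiv ℝ f) y (EuclideanSpace.single a 1) (EuclideanSpace.single b 1) := by
    intro a b
    change fderiv ℝ (fun z => fderiv ℝ f z (EuclideanSpace.single b 1)) y _ = _
    rw [fderiv_clm_apply hd (differentiableAt_const _)]
    simp
  rw [h, h]
  exact hs _ _

/-- The Jacobian matrix of a map between Euclidean spaces. -/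
def jacobian (Φ : EuclideanSpace ℝ (Fin n) → EuclideanSpace ℝ (Fin n))
    (y : EuclideanSpace ℝ (Fin n)) : Matrix (Fin n) (Fin n) ℝ :=
  of fun k i => pderiv i (fun z => Φ z k) y

variable {Φ : EuclideanSpace ℝ (Fin n) → EuclideanSpace ℝ (Fin n)}

lemma fderiv_single_eq_sum (hΦ : DifferentiableAt ℝ Φ y) (i : Fin n) :
    fderiv ℝ Φ y (EuclideanSpace.single i 1) =
      ∑ k, jacobian Φ y k i • EuclideanSpace.single k (1 : ℝ) := by
  have h : ∀ k, jacobian Φ y k i = fderiv ℝ Φ y (EuclideanSpace.single i 1) k := by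
    intro k
    have := ((EuclideanSpace.proj (𝕜 := ℝ) k).hasFDerivAt.comp y hΦ.hasFDerivAt).fderiv
    have h2 : fderiv ℝ (fun z => Φ z k) y = _ := this
    simp only [jacobian, of_apply, pderiv, h2]
    rfl
  ext l
  simp [h, Pi.single_apply]

lemma pderiv_comp_map {f : EuclideanSpace ℝ (Fin n) → ℝ} (hf : DifferentiableAt ℝ f (Φ y))
    (hΦ : DifferentiableAt ℝ Φ y) (i : Fin n) :
    pderiv i (fun z => f (Φ z)) y = ∑ l, pderiv l f (Φ y) * jacobian Φ y l i := by
  have h : fderiv ℝ (fun z => f (Φ z)) y = _ := (hf.hasFDerivAt.comp y hΦ.hasFDerivAt).fderiv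
  simp only [pderiv, h, ContinuousLinearMap.comp_apply, fderiv_single_eq_sum hΦ, map_sum, map_smul,
    smul_eq_mul]
  exact Finset.sum_congr rfl fun l _ => mul_comm _ _

lemma contDiffAt_jacobian {k m : WithTop ℕ∞} (hΦ : ContDiffAt ℝ m Φ y) (hk : k + 1 ≤ m)
    (a b : Fin n) : ContDiffAt ℝ k (fun z => jacobian Φ z a b) y :=
  contDiffAt_pderiv (f := fun z => Φ z a)
    ((EuclideanSpace.proj (𝕜 := ℝ) a).contDiff.contDiffAt.comp y hΦ) hk b

/-- The divergence of the Piola transform of a vector field. -/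
lemma sum_pderiv_adjugate_jacobian (hΦ : ContDiffAt ℝ 2 Φ y) (hdet : (jacobian Φ y).det ≠ 0)
    {Y : Fin n → EuclideanSpace ℝ (Fin n) → ℝ} (hY : ∀ k, DifferentiableAt ℝ (Y k) (Φ y)) :
    ∑ i, pderiv i (fun z => ∑ k, (jacobian Φ z).adjugate i k * Y k (Φ z)) y =
      (jacobian Φ y).det * ∑ k, pderiv k (Y k) (Φ y) := by
  have hΦd : DifferentiableAt ℝ Φ y := hΦ.differentiableAt (by simp)
  have hJ := contDiffAt_jacobian (k := 1) hΦ (by norm_num)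
  have hda : ∀ a b, DifferentiableAt ℝ (fun z => (jacobian Φ z).adjugate a b) y := fun a b =>
    (contDiffAt_adjugate hJ a b).differentiableAt (by simp)
  have hYd : ∀ k, DifferentiableAt ℝ (fun z => Y k (Φ z)) y := fun k => (hY k).comp y hΦd
  have h1 : ∀ i, pderiv i (fun z => ∑ k, (jacobian Φ z).adjugate i k * Y k (Φ z)) y =
      ∑ k, ((jacobian Φ y).adjugate i k * (∑ l, pderiv l (Y k) (Φ y) * jacobian Φ y l i) +
        pderiv i (fun z => (jacobian Φ z).adjugate i k) y * Y k (Φ y)) := by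
    intro i
    rw [pderiv_sum fun k _ => (hda i k).fun_mul (hYd k)]
    refine Finset.sum_congr rfl fun k _ => ?_
    rw [pderiv_mul (hda i k) (hYd k), pderiv_comp_map (hY k) hΦd]
  have hsymm : ∀ i a b, pderiv i (fun z => jacobian Φ z b a) y =
      pderiv a (fun z => jacobian Φ z b i) y := fun i a b =>
    pderiv_pderiv_comm (f := fun z => Φ z b)
      ((EuclideanSpace.proj (𝕜 := ℝ) b).contDiff.contDiffAt.comp y hΦ) i a
  rw [Finset.sum_congr rfl fun i _ => h1 i, Finset.sum_comm, Finset.mul_sum]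
  refine Finset.sum_congr rfl fun k _ => ?_
  rw [Finset.sum_add_distrib, ← Finset.sum_mul, sum_pderiv_adjugate hJ hsymm hdet, zero_mul,
    add_zero]
  simp only [Finset.mul_sum]
  rw [Finset.sum_comm]
  have h2 : ∀ l, ∑ i, (jacobian Φ y).adjugate i k * (pderiv l (Y k) (Φ y) * jacobian Φ y l i) =
      pderiv l (Y k) (Φ y) * ((jacobian Φ y).det * (1 : Matrix (Fin n) (Fin n) ℝ) l k) := by
    intro l
    have := congrFun (congrFun (mul_adjugate (jacobian Φ y)) l) k
    rw [mul_apply, Matrix.smul_apply, smul_eq_mul] at this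
    rw [← this, Finset.mul_sum]
    exact Finset.sum_congr rfl fun i _ => by ring
  rw [Finset.sum_congr rfl fun l _ => h2 l]
  simp [one_apply, mul_comm]

end piola

/-! ### Changes of chart, the metric and invariance of the Laplace operator -/

section transition

variable {n : ℕ} {M : Type*} [TopologicalSpace M]
  {e e' : OpenPartialHomeomorph M (EuclideanSpace ℝ (Fin n))} {y : EuclideanSpace ℝ (Fin n)}

lemma eventually_symm_mem_source (hy : y ∈ e.target) (hy' : e.symm y ∈ e'.source) :
    ∀ᶠ z in 𝓝 y, z ∈ e.target ∧ e.symm z ∈ e'.source :=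
  Filter.Eventually.and (e.open_target.mem_nhds hy)
    ((e.symm.continuousAt (by simpa using hy)).eventually (e'.open_source.mem_nhds hy'))

variable [ChartedSpace (EuclideanSpace ℝ (Fin n)) M]

lemma mdifferentiable_of_mem_maximalAtlas (he : e ∈ IsManifold.maximalAtlas (𝓡 n) ∞ M) :
    e.MDifferentiable (𝓡 n) (𝓡 n) :=
  ⟨(contMDiffOn_of_mem_maximalAtlas he).mdifferentiableOn (by simp),
    (contMDiffOn_symm_of_mem_maximalAtlas he).mdifferentiableOn (by simp)⟩

/-- The change of coordinates between two charts is smooth. -/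
lemma contDiffAt_transition (he : e ∈ IsManifold.maximalAtlas (𝓡 n) ∞ M)
    (he' : e' ∈ IsManifold.maximalAtlas (𝓡 n) ∞ M) (hy : y ∈ e.target)
    (hy' : e.symm y ∈ e'.source) : ContDiffAt ℝ ∞ (fun z => e' (e.symm z)) y := by
  have hs : ContMDiffAt (𝓡 n) (𝓡 n) ∞ e.symm y :=
    (contMDiffOn_symm_of_mem_maximalAtlas he).contMDiffAt (e.open_target.mem_nhds hy)
  have hs' : ContMDiffAt (𝓡 n) (𝓡 n) ∞ e' (e.symm y) :=
    (contMDiffOn_of_mem_maximalAtlas he').contMDiffAt (e'.open_source.mem_nhds hy')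
  exact contMDiffAt_iff_contDiffAt.1 (hs'.comp y hs)

lemma differentiableAt_pderiv_comp_symm {φ : M → ℝ} (hφ : ContMDiff (𝓡 n) 𝓘(ℝ, ℝ) 2 φ)
    (he : e ∈ IsManifold.maximalAtlas (𝓡 n) ∞ M) (hy : y ∈ e.target) (j : Fin n) :
    DifferentiableAt ℝ (pderiv j (φ ∘ e.symm)) y :=
  (contDiffAt_pderiv (contDiffAt_comp_symm (k := 2) he hy hφ.contMDiffAt) (k := 1)
    (by norm_num) j).differentiableAt (by simp)

/-- The derivative of the inverse chart, as a linear map of the model space. -/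
def symmDeriv (e : OpenPartialHomeomorph M (EuclideanSpace ℝ (Fin n)))
    (y : EuclideanSpace ℝ (Fin n)) : EuclideanSpace ℝ (Fin n) →L[ℝ] EuclideanSpace ℝ (Fin n) :=
  mfderiv (𝓡 n) (𝓡 n) e.symm y

lemma symmDeriv_eq (he : e ∈ IsManifold.maximalAtlas (𝓡 n) ∞ M)
    (he' : e' ∈ IsManifold.maximalAtlas (𝓡 n) ∞ M) (hy : y ∈ e.target)
    (hy' : e.symm y ∈ e'.source) (v : EuclideanSpace ℝ (Fin n)) :
    symmDeriv e y v =
      symmDeriv e' (e' (e.symm y)) (fderiv ℝ (fun z => e' (e.symm z)) y v) := by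
  have hΦ : MDifferentiableAt (𝓡 n) (𝓡 n) (fun z => e' (e.symm z)) y :=
    ((contDiffAt_transition he he' hy hy').differentiableAt (by simp)).mdifferentiableAt
  have hs : MDifferentiableAt (𝓡 n) (𝓡 n) e'.symm (e' (e.symm y)) :=
    (mdifferentiable_of_mem_maximalAtlas he').mdifferentiableAt_symm (e'.map_source hy')
  have heq : e.symm =ᶠ[𝓝 y] e'.symm ∘ fun z => e' (e.symm z) := by
    filter_upwards [eventually_symm_mem_source hy hy'] with z hz
    exact (e'.left_inv hz.2).symm
  have h1 : symmDeriv e y =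
      (symmDeriv e' (e' (e.symm y))).comp (fderiv ℝ (fun z => e' (e.symm z)) y) := by
    have h2 := heq.mfderiv_eq (I := 𝓡 n) (I' := 𝓡 n)
    rw [mfderiv_comp y hs hΦ, mfderiv_eq_fderiv] at h2
    exact h2
  rw [h1]
  rfl

end transition

section metric

open Matrix Bundle

variable {n : ℕ} {M : Type*} [TopologicalSpace M] [ChartedSpace (EuclideanSpace ℝ (Fin n)) M]
  [IsManifold (𝓡 n) ∞ M] {g : SmoothMetric n M}
  {e e' : OpenPartialHomeomorph M (EuclideanSpace ℝ (Fin n))} {y : EuclideanSpace ℝ (Fin n)}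

/-- The coordinate field is the image of a constant field under the tangent map of the inverse
chart. -/
lemma contMDiffAt_coordVec (he : e ∈ IsManifold.maximalAtlas (𝓡 n) ∞ M) (hy : y ∈ e.target)
    (i : Fin n) : ContMDiffAt (𝓡 n) (𝓡 n).tangent ∞
      (fun z => (⟨e.symm z, coordVec e i z⟩ : TangentBundle (𝓡 n) M)) y := by
  have hs : ContMDiffAt (𝓡 n) (𝓡 n) ∞ e.symm y :=
    (contMDiffOn_symm_of_mem_maximalAtlas he).contMDiffAt (e.open_target.mem_nhds hy)
  have hv : ContMDiffAt (𝓡 n) (𝓡 n).tangent ∞ (fun z : EuclideanSpace ℝ (Fin n) =>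
      (⟨z, EuclideanSpace.single i (1 : ℝ)⟩ : TangentBundle (𝓡 n) (EuclideanSpace ℝ (Fin n)))) y :=
    contMDiffAt_vectorSpace_iff_contDiffAt.2 contDiffAt_const
  exact ContMDiffAt.clm_apply_of_inCoordinates (hs.mfderiv_const (m := ∞) (by simp)) hv hs

lemma contDiffAt_metricMatrix (he : e ∈ IsManifold.maximalAtlas (𝓡 n) ∞ M) (hy : y ∈ e.target)
    (i j : Fin n) : ContDiffAt ℝ ∞ (fun z => metricMatrix g e z i j) y := by
  have hs : ContMDiffAt (𝓡 n) (𝓡 n) ∞ e.symm y :=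
    (contMDiffOn_symm_of_mem_maximalAtlas he).contMDiffAt (e.open_target.mem_nhds hy)
  have : ContMDiffAt (𝓡 n) ((𝓡 n).prod 𝓘(ℝ)) ∞
      (fun z => TotalSpace.mk' ℝ (E := Bundle.Trivial M ℝ) (e.symm z)
        (g.inner (e.symm z) (coordVec e i z) (coordVec e j z))) y := by
    apply ContMDiffAt.clm_bundle_apply₂ (F₁ := EuclideanSpace ℝ (Fin n))
      (F₂ := EuclideanSpace ℝ (Fin n))
    · exact ContMDiffAt.comp y g.contMDiff.contMDiffAt hs
    · exact contMDiffAt_coordVec he hy i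
    · exact contMDiffAt_coordVec he hy j
  rw [contMDiffAt_totalSpace] at this
  exact contMDiffAt_iff_contDiffAt.1 this.2

/-- The metric at a point, as a bilinear form on the model space. -/
def modelInner (g : SmoothMetric n M) (x : M) :
    EuclideanSpace ℝ (Fin n) →L[ℝ] EuclideanSpace ℝ (Fin n) →L[ℝ] ℝ := g.inner x

lemma metricMatrix_apply (i j : Fin n) : metricMatrix g e y i j =
    modelInner g (e.symm y) (symmDeriv e y (EuclideanSpace.single i 1))
      (symmDeriv e y (EuclideanSpace.single j 1)) := rfl

lemma metricMatrix_isSymm : (metricMatrix g e y).IsSymm := by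
  ext i j
  exact g.symm _ _ _

/-- The quadratic form of the matrix is `g` evaluated on the image of a vector under the derivative
of the inverse chart, which is injective. -/
lemma metricMatrix_posDef (he : e ∈ IsManifold.maximalAtlas (𝓡 n) ∞ M) (hy : y ∈ e.target) :
    (metricMatrix g e y).PosDef := by
  refine PosDef.of_dotProduct_mulVec_pos ?_ fun v hv => ?_
  · ext i j
    exact g.symm _ _ _
  · set w : EuclideanSpace ℝ (Fin n) := ∑ i, v i • EuclideanSpace.single i (1 : ℝ) with hw
    have hwv : ∀ i, w i = v i := fun i => by simp [hw, Pi.single_apply]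
    have hw0 : w ≠ 0 := fun h => hv (by
      funext i
      rw [← hwv i, h]
      rfl)
    have hinj : Function.Injective (symmDeriv e y) :=
      (mdifferentiable_of_mem_maximalAtlas he).symm.mfderiv_injective (by simpa using hy)
    have hTw : symmDeriv e y w ≠ 0 := fun h => hw0 (hinj (h.trans (map_zero _).symm))
    have hpos : 0 < modelInner g (e.symm y) (symmDeriv e y w) (symmDeriv e y w) :=
      g.pos (e.symm y) _ hTw
    refine hpos.trans_eq ?_
    rw [hw]
    simp only [map_sum, map_smul, _root_.sum_apply, _root_.smul_apply, smul_eq_mul, star_trivial,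
      dotProduct, mulVec, Finset.mul_sum, metricMatrix_apply]
    rw [Finset.sum_comm]
    exact Finset.sum_congr rfl fun i _ => Finset.sum_congr rfl fun j _ => by ring

lemma metricMatrix_eq (he : e ∈ IsManifold.maximalAtlas (𝓡 n) ∞ M)
    (he' : e' ∈ IsManifold.maximalAtlas (𝓡 n) ∞ M) (hy : y ∈ e.target)
    (hy' : e.symm y ∈ e'.source) :
    metricMatrix g e y = (jacobian (fun z => e' (e.symm z)) y)ᵀ *
      metricMatrix g e' (e' (e.symm y)) * jacobian (fun z => e' (e.symm z)) y := by
  have hΦ : DifferentiableAt ℝ (fun z => e' (e.symm z)) y :=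
    (contDiffAt_transition he he' hy hy').differentiableAt (by simp)
  ext i j
  rw [metricMatrix_apply]
  simp only [symmDeriv_eq he he' hy hy', fderiv_single_eq_sum hΦ, map_sum, map_smul,
    _root_.sum_apply, _root_.smul_apply, smul_eq_mul, Matrix.mul_apply, Matrix.transpose_apply,
    metricMatrix_apply, e'.left_inv hy', Finset.mul_sum, Finset.sum_mul]
  exact Finset.sum_congr rfl fun k _ => Finset.sum_congr rfl fun l _ => by ring

/-- The components of the densitized gradient `√G gⁱʲ ∂ⱼφ` in the chart `e`. -/
def gradDensity (g : SmoothMetric n M) (e : OpenPartialHomeomorph M (EuclideanSpace ℝ (Fin n)))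
    (φ : M → ℝ) (i : Fin n) (y : EuclideanSpace ℝ (Fin n)) : ℝ :=
  ∑ j, (metricMatrix g e y)⁻¹ i j * √(metricMatrix g e y).det * pderiv j (φ ∘ e.symm) y

lemma contDiffAt_metric_coeff (he : e ∈ IsManifold.maximalAtlas (𝓡 n) ∞ M) (hy : y ∈ e.target)
    (i j : Fin n) : ContDiffAt ℝ ∞
      (fun z => (metricMatrix g e z)⁻¹ i j * √(metricMatrix g e z).det) y := by
  have hdet := (metricMatrix_posDef (g := g) he hy).det_pos.ne'
  exact (contDiffAt_inv (contDiffAt_metricMatrix he hy) hdet i j).mul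
    ((contDiffAt_det (contDiffAt_metricMatrix he hy)).sqrt hdet)

lemma differentiableAt_metric_coeff (he : e ∈ IsManifold.maximalAtlas (𝓡 n) ∞ M)
    (hy : y ∈ e.target) (i j : Fin n) : DifferentiableAt ℝ
      (fun z => (metricMatrix g e z)⁻¹ i j * √(metricMatrix g e z).det) y :=
  (contDiffAt_metric_coeff he hy i j).differentiableAt (by simp)

lemma differentiableAt_gradDensity {φ : M → ℝ} (hφ : ContMDiff (𝓡 n) 𝓘(ℝ, ℝ) 2 φ)
    (he : e ∈ IsManifold.maximalAtlas (𝓡 n) ∞ M) (hy : y ∈ e.target) (i : Fin n) :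
    DifferentiableAt ℝ (gradDensity g e φ i) y :=
  DifferentiableAt.fun_sum fun j _ => (differentiableAt_metric_coeff he hy i j).fun_mul
    (differentiableAt_pderiv_comp_symm hφ he hy j)

lemma laplaceInChart_eq_sum_pderiv {φ : M → ℝ} (hφ : ContMDiff (𝓡 n) 𝓘(ℝ, ℝ) 2 φ)
    (he : e ∈ IsManifold.maximalAtlas (𝓡 n) ∞ M) {x : M} (hx : x ∈ e.source) :
    laplaceInChart g e φ x = 1 / √(metricMatrix g e (e x)).det *
      ∑ i, pderiv i (gradDensity g e φ i) (e x) := by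
  rw [laplaceInChart]
  congr 1
  refine Finset.sum_congr rfl fun i _ => ?_
  exact (pderiv_sum (fun j _ => (differentiableAt_metric_coeff he (e.map_source hx) i j).fun_mul
    (differentiableAt_pderiv_comp_symm hφ he (e.map_source hx) j)) i).symm

/-- In `G = Jᵀ G' J` the left side has positive determinant, so `det J ≠ 0`; any metric will do. -/
lemma jacobian_det_ne_zero [Nonempty (SmoothMetric n M)]
    (he : e ∈ IsManifold.maximalAtlas (𝓡 n) ∞ M)
    (he' : e' ∈ IsManifold.maximalAtlas (𝓡 n) ∞ M) (hy : y ∈ e.target)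
    (hy' : e.symm y ∈ e'.source) : (jacobian (fun z => e' (e.symm z)) y).det ≠ 0 := by
  obtain ⟨g⟩ := ‹Nonempty (SmoothMetric n M)›
  have h := (metricMatrix_posDef (g := g) he hy).det_pos
  rw [metricMatrix_eq he he' hy hy', det_mul] at h
  exact right_ne_zero_of_mul (ne_of_gt h)

/-- The densitized gradient transforms by the Piola transform. -/
lemma gradDensity_eq {φ : M → ℝ} (hφ : ContMDiff (𝓡 n) 𝓘(ℝ, ℝ) 2 φ)
    (he : e ∈ IsManifold.maximalAtlas (𝓡 n) ∞ M)
    (he' : e' ∈ IsManifold.maximalAtlas (𝓡 n) ∞ M) (hy : y ∈ e.target)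
    (hy' : e.symm y ∈ e'.source) (i : Fin n) :
    gradDensity g e φ i y = SignType.sign (jacobian (fun z => e' (e.symm z)) y).det *
      ∑ k, (jacobian (fun z => e' (e.symm z)) y).adjugate i k *
        gradDensity g e' φ k (e' (e.symm y)) := by
  have : Nonempty (SmoothMetric n M) := ⟨g⟩
  have hdet := jacobian_det_ne_zero he he' hy hy'
  have hm := metricMatrix_eq (g := g) he he' hy hy'
  have hΦ : DifferentiableAt ℝ (fun z => e' (e.symm z)) y :=
    (contDiffAt_transition he he' hy hy').differentiableAt (by simp)
  have hψ : DifferentiableAt ℝ (φ ∘ e'.symm) (e' (e.symm y)) :=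
    (contDiffAt_comp_symm (k := 2) he' (e'.map_source hy') hφ.contMDiffAt).differentiableAt
      (by simp)
  have heq : φ ∘ e.symm =ᶠ[𝓝 y] fun z => (φ ∘ e'.symm) (e' (e.symm z)) := by
    filter_upwards [eventually_symm_mem_source hy hy'] with z hz
    simp [e'.left_inv hz.2]
  set J := jacobian (fun z => e' (e.symm z)) y
  set G := metricMatrix g e y
  set G' := metricMatrix g e' (e' (e.symm y))
  let d : Fin n → ℝ := fun j => pderiv j (φ ∘ e.symm) y
  let d' : Fin n → ℝ := fun j => pderiv j (φ ∘ e'.symm) (e' (e.symm y))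
  have hd : d = Jᵀ *ᵥ d' := by
    funext j
    simp only [d, (pderiv_congr heq j).self_of_nhds]
    rw [pderiv_comp_map hψ hΦ]
    exact Finset.sum_congr rfl fun l _ => mul_comm _ _
  have hu : IsUnit J.det := isUnit_iff_ne_zero.2 hdet
  have hsqrt : √G.det = |J.det| * √G'.det := by
    rw [hm, det_mul, det_mul, det_transpose, mul_right_comm, ← pow_two,
      Real.sqrt_mul (sq_nonneg _), Real.sqrt_sq_eq_abs]
  have hinv : G⁻¹ *ᵥ d = J⁻¹ *ᵥ (G'⁻¹ *ᵥ d') := by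
    rw [hm, hd, Matrix.mul_inv_rev, Matrix.mul_inv_rev, mulVec_mulVec, mulVec_mulVec]
    congr 1
    rw [Matrix.mul_assoc, Matrix.mul_assoc, nonsing_inv_mul _ (by rwa [det_transpose]),
      Matrix.mul_one]
  -- The factor `|det J|` from `√G` turns the inverse Jacobian into the adjugate, leaving only a
  -- sign.
  have hadj : |J.det| • J⁻¹ = (SignType.sign J.det : ℝ) • J.adjugate := by
    rw [inv_def, Ring.inverse_eq_inv', smul_smul, ← sign_mul_self J.det, mul_assoc,
      mul_inv_cancel₀ hdet, mul_one]
  have hL : ∀ (m : OpenPartialHomeomorph M (EuclideanSpace ℝ (Fin n)))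
      (z : EuclideanSpace ℝ (Fin n)) (k : Fin n), gradDensity g m φ k z =
      √(metricMatrix g m z).det *
        ((metricMatrix g m z)⁻¹ *ᵥ fun j => pderiv j (φ ∘ m.symm) z) k := by
    intro m z k
    simp only [gradDensity, mulVec, dotProduct, Finset.mul_sum]
    exact Finset.sum_congr rfl fun j _ => by ring
  have h1 : gradDensity g e φ i y = √G.det * (G⁻¹ *ᵥ d) i := hL e y i
  have h2 : (fun k => gradDensity g e' φ k (e' (e.symm y))) = √G'.det • (G'⁻¹ *ᵥ d') :=
    funext fun k => hL e' _ k
  have h3 : √G.det • (G⁻¹ *ᵥ d) = (SignType.sign J.det : ℝ) •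
      (J.adjugate *ᵥ fun k => gradDensity g e' φ k (e' (e.symm y))) := by
    rw [h2, hsqrt, hinv, ← smul_mulVec (SignType.sign J.det : ℝ), ← hadj, smul_mulVec, mulVec_smul,
      smul_smul]
  rw [h1]
  exact congrFun h3 i

/-- The Laplace operator does not depend on the chart. -/
theorem laplaceInChart_eq {φ : M → ℝ} (hφ : ContMDiff (𝓡 n) 𝓘(ℝ, ℝ) 2 φ)
    (he : e ∈ IsManifold.maximalAtlas (𝓡 n) ∞ M)
    (he' : e' ∈ IsManifold.maximalAtlas (𝓡 n) ∞ M) {x : M} (hx : x ∈ e.source)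
    (hx' : x ∈ e'.source) : laplaceInChart g e φ x = laplaceInChart g e' φ x := by
  have : Nonempty (SmoothMetric n M) := ⟨g⟩
  have hy := e.map_source hx
  have hxy : e.symm (e x) = x := e.left_inv hx
  have hy' : e.symm (e x) ∈ e'.source := hxy.symm ▸ hx'
  have hΦ := contDiffAt_transition he he' hy hy'
  have hdet := jacobian_det_ne_zero he he' hy hy'
  rw [laplaceInChart_eq_sum_pderiv hφ he hx, laplaceInChart_eq_sum_pderiv hφ he' hx']
  set Φ : EuclideanSpace ℝ (Fin n) → EuclideanSpace ℝ (Fin n) := fun z => e' (e.symm z) with hΦdef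
  have hΦx : Φ (e x) = e' x := congrArg e' hxy
  obtain ⟨σ, hσ⟩ : ∃ σ : ℝ, σ = (SignType.sign (jacobian Φ (e x)).det : ℝ) := ⟨_, rfl⟩
  have hdetc : ContinuousAt (fun z => (jacobian Φ z).det) (e x) :=
    (contDiffAt_det (contDiffAt_jacobian (k := 1) hΦ one_add_one_le_infty)).continuousAt
  -- The sign is locally constant, so it passes through the derivatives; multiplied by the `det J`
  -- of the Piola formula it gives `|det J|`, which cancels against `√G = |det J| √G'`.
  have hsign : ∀ᶠ z in 𝓝 (e x), (SignType.sign (jacobian Φ z).det : ℝ) = σ := by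
    rcases lt_or_gt_of_ne hdet with h | h
    · filter_upwards [hdetc.eventually_lt_const h] with z hz
      rw [hσ, sign_neg hz, sign_neg h]
    · filter_upwards [hdetc.eventually_const_lt h] with z hz
      rw [hσ, sign_pos hz, sign_pos h]
  have hX : ∀ i, gradDensity g e φ i =ᶠ[𝓝 (e x)] fun z =>
      σ * ∑ k, (jacobian Φ z).adjugate i k * gradDensity g e' φ k (Φ z) := by
    intro i
    filter_upwards [hsign, eventually_symm_mem_source hy hy'] with z hz hz'
    rw [gradDensity_eq hφ he he' hz'.1 hz'.2 i, ← hz]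
  have hJ := contDiffAt_jacobian (k := 1) hΦ one_add_one_le_infty
  have hYd : ∀ k, DifferentiableAt ℝ (gradDensity g e' φ k) (Φ (e x)) := fun k =>
    differentiableAt_gradDensity hφ he' (e'.map_source hy') k
  have hterm : ∀ i, DifferentiableAt ℝ (fun z => ∑ k, (jacobian Φ z).adjugate i k *
      gradDensity g e' φ k (Φ z)) (e x) := fun i =>
    DifferentiableAt.fun_sum fun k _ =>
      ((contDiffAt_adjugate hJ i k).differentiableAt (by simp)).fun_mul
        ((hYd k).comp (e x) (hΦ.differentiableAt (by simp)))
  have hsum : ∑ i, pderiv i (gradDensity g e φ i) (e x) =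
      |(jacobian Φ (e x)).det| * ∑ k, pderiv k (gradDensity g e' φ k) (e' x) := by
    rw [Finset.sum_congr rfl fun i _ => ((pderiv_congr (hX i) i).self_of_nhds.trans
      (pderiv_const_mul (hterm i) σ i)), ← Finset.mul_sum,
      sum_pderiv_adjugate_jacobian (hΦ.of_le two_le_infty) hdet hYd, ← mul_assoc, hσ,
      sign_mul_self, hΦx]
  have hsqrt : √(metricMatrix g e (e x)).det =
      |(jacobian Φ (e x)).det| * √(metricMatrix g e' (e' x)).det := by
    rw [metricMatrix_eq he he' hy hy', det_mul, det_mul, det_transpose, mul_right_comm, ← pow_two,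
      Real.sqrt_mul (sq_nonneg _), Real.sqrt_sq_eq_abs, hxy]
  have hpos' : √(metricMatrix g e' (e' x)).det ≠ 0 :=
    (Real.sqrt_pos.2 (metricMatrix_posDef he' (e'.map_source hx')).det_pos).ne'
  have habs : |(jacobian Φ (e x)).det| ≠ 0 := abs_ne_zero.2 hdet
  rw [hsum, hsqrt]
  field_simp

end metric

/-! ### Ellipticity of the Laplace operator and exhaustion functions -/

section laplace

open Matrix

/-- The eigenvalues of the inverse of a positive definite matrix are bounded below in terms of the
entries of the matrix. -/
lemma one_le_mul_of_hasEigenvalue_inv {n : ℕ} {G : Matrix (Fin n) (Fin n) ℝ} (hG : G.PosDef)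
    {μ : ℝ} (hμ : Module.End.HasEigenvalue (Matrix.toLin' G⁻¹) μ) :
    1 ≤ μ * ∑ i, ∑ j, |G i j| := by
  obtain ⟨v, hv⟩ := hμ.exists_hasEigenvector
  have h1 : G⁻¹ *ᵥ v = μ • v := by
    have := hv.apply_eq_smul
    rwa [Matrix.toLin'_apply] at this
  have hu : IsUnit G.det := isUnit_iff_ne_zero.2 hG.det_pos.ne'
  have h2 : v = μ • (G *ᵥ v) := by
    have := congrArg (fun w => G *ᵥ w) h1
    simp only [mulVec_mulVec, mul_nonsing_inv _ hu, one_mulVec, mulVec_smul] at this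
    exact this
  have hpos := hG.dotProduct_mulVec_pos hv.2
  rw [star_trivial] at hpos
  have hvv : 0 < v ⬝ᵥ v := by
    have := (dotProduct_star_self_pos_iff (v := v)).2 hv.2
    rwa [star_trivial] at this
  -- Pairing `v = μ G v` with `v`; the entries of `G` bound the form `v · G v`, so `μ` cannot be
  -- small.
  have h3 : v ⬝ᵥ v = μ * (v ⬝ᵥ (G *ᵥ v)) := by
    conv_lhs => rw [h2, smul_dotProduct, smul_eq_mul, dotProduct_comm, ← h2]
  have hμ0 : 0 < μ := by
    rw [h3] at hvv
    exact pos_of_mul_pos_left hvv hpos.le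
  have hsq : ∀ i, v i ^ 2 ≤ v ⬝ᵥ v := fun i => by
    rw [pow_two]
    exact Finset.single_le_sum (f := fun i => v i * v i) (fun j _ => mul_self_nonneg _)
      (Finset.mem_univ i)
  have h4 : v ⬝ᵥ (G *ᵥ v) ≤ (∑ i, ∑ j, |G i j|) * (v ⬝ᵥ v) := by
    simp only [Finset.sum_mul]
    rw [dotProduct]
    refine Finset.sum_le_sum fun i _ => ?_
    rw [mulVec, dotProduct, Finset.mul_sum]
    refine Finset.sum_le_sum fun j _ => ?_
    calc v i * (G i j * v j) ≤ |v i * (G i j * v j)| := le_abs_self _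
      _ = |G i j| * (|v i| * |v j|) := by
        rw [abs_mul, abs_mul]
        ring
      _ ≤ |G i j| * (v ⬝ᵥ v) := by
        refine mul_le_mul_of_nonneg_left ?_ (abs_nonneg _)
        have h5 := hsq i
        have h6 := hsq j
        have h7 := two_mul_le_add_sq |v i| |v j|
        rw [sq_abs, sq_abs] at h7
        linarith
  have h5 := mul_le_mul_of_nonneg_left h4 hμ0.le
  rw [← h3, ← mul_assoc] at h5
  exact (le_mul_iff_one_le_left hvv).1 h5

variable {n : ℕ} {M : Type*} [TopologicalSpace M] [ChartedSpace (EuclideanSpace ℝ (Fin n)) M]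
  [IsManifold (𝓡 n) ∞ M]

/-- The operator is evaluated at each point in the preferred chart there; invariance allows one
fixed chart `e` instead. The product rule then gives leading coefficients `gⁱʲ`, first-order
coefficients `G^{-1/2} ∑ᵢ ∂ᵢ(gⁱʲ √G)` and no zeroth-order term. -/
theorem isLocallyUniformlyElliptic_laplace (g : SmoothMetric n M) :
    IsLocallyUniformlyElliptic (n := n) fun φ x =>
      laplaceInChart g (chartAt (EuclideanSpace ℝ (Fin n)) x) φ x := by
  intro e he
  have hG : ∀ y ∈ e.target, ∀ i j, ContDiffAt ℝ ∞ (fun z => metricMatrix g e z i j) y :=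
    fun y hy => contDiffAt_metricMatrix he hy
  have hpos : ∀ y ∈ e.target, (metricMatrix g e y).PosDef := fun y hy => metricMatrix_posDef he hy
  have hsqrt : ∀ y ∈ e.target, √(metricMatrix g e y).det ≠ 0 := fun y hy =>
    (Real.sqrt_pos.2 (hpos y hy).det_pos).ne'
  refine ⟨fun x => (metricMatrix g e (e x))⁻¹, fun x j => 1 / √(metricMatrix g e (e x)).det *
      ∑ i, pderiv i (fun y => (metricMatrix g e y)⁻¹ i j * √(metricMatrix g e y).det) (e x),
    fun _ => 0, fun i j => ?_, fun j => ?_, ?_, fun x _ => ?_, fun p hp => ?_, fun φ hφ x hx => ?_⟩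
  · exact (continuousOn_comp_chart fun y hy =>
      (contDiffAt_inv (hG y hy) (hpos y hy).det_pos.ne' i j).continuousAt).locallyBoundedOn
  · refine (continuousOn_comp_chart (f := fun y => 1 / √(metricMatrix g e y).det * ∑ i, pderiv i
      (fun y => (metricMatrix g e y)⁻¹ i j * √(metricMatrix g e y).det) y)
      fun y hy => ?_).locallyBoundedOn
    refine (continuousAt_const.div (contDiffAt_det (hG y hy)).continuousAt.sqrt
      (hsqrt y hy)).mul ?_
    exact tendsto_finsetSum _ fun i _ => (contDiffAt_pderiv (contDiffAt_metric_coeff he hy i j)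
      (k := 1) one_add_one_le_infty i).continuousAt
  · exact continuousOn_const.locallyBoundedOn
  · exact metricMatrix_isSymm.inv
  · have hc : ContinuousOn (fun x => ∑ i, ∑ j, |metricMatrix g e (e x) i j|) e.source :=
      continuousOn_comp_chart (f := fun y => ∑ i, ∑ j, |metricMatrix g e y i j|) fun y hy =>
        tendsto_finsetSum _ fun i _ => tendsto_finsetSum _ fun j _ =>
          (hG y hy i j).continuousAt.abs
    have h0 : 0 ≤ ∑ i, ∑ j, |metricMatrix g e (e p) i j| :=
      Finset.sum_nonneg fun i _ => Finset.sum_nonneg fun j _ => abs_nonneg _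
    refine ⟨(∑ i, ∑ j, |metricMatrix g e (e p) i j| + 1)⁻¹, by positivity, ?_⟩
    filter_upwards [(hc p hp).eventually_lt_const (lt_add_one _), self_mem_nhdsWithin]
      with x hlt hx μ hμ
    have h1 := one_le_mul_of_hasEigenvalue_inv (hpos _ (e.map_source hx)) hμ
    have hS : 0 ≤ ∑ i, ∑ j, |metricMatrix g e (e x) i j| :=
      Finset.sum_nonneg fun i _ => Finset.sum_nonneg fun j _ => abs_nonneg _
    have hμ0 : 0 ≤ μ := by
      by_contra! h
      have := mul_nonpos_of_nonpos_of_nonneg h.le hS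
      linarith
    rw [inv_le_iff_one_le_mul₀ (by positivity)]
    exact h1.trans (mul_le_mul_of_nonneg_left hlt.le hμ0)
  · have hy := e.map_source hx
    beta_reduce
    rw [laplaceInChart_eq hφ (IsManifold.chart_mem_maximalAtlas x) he (mem_chart_source _ x) hx,
      laplaceInChart]
    have h1 : ∀ i j, pderiv i (fun y => (metricMatrix g e y)⁻¹ i j * √(metricMatrix g e y).det *
        pderiv j (φ ∘ e.symm) y) (e x) = _ := fun i j =>
      pderiv_mul (differentiableAt_metric_coeff he hy i j)
        (differentiableAt_pderiv_comp_symm hφ he hy j) i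
    simp only [h1, Finset.sum_add_distrib, mul_add, zero_mul, add_zero]
    congr 1
    · simp only [Finset.mul_sum]
      refine Finset.sum_congr rfl fun i _ => Finset.sum_congr rfl fun j _ => ?_
      have := hsqrt _ hy
      field_simp
    · rw [Finset.sum_comm]
      simp only [Finset.mul_sum, Finset.sum_mul]
      exact Finset.sum_congr rfl fun j _ => Finset.sum_congr rfl fun i _ => by ring

/-- The index of the first member of a compact exhaustion containing `x` is locally bounded above,
so a partition of unity yields a smooth function exceeding it; its sublevel sets lie in members of
the exhaustion. -/
lemma exists_continuous_pos_isExhaustion (n : ℕ) (M : Type*) [TopologicalSpace M] [T2Space M]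
    [SecondCountableTopology M] [ChartedSpace (EuclideanSpace ℝ (Fin n)) M]
    [IsManifold (𝓡 n) ∞ M] :
    ∃ ρ : M → ℝ, Continuous ρ ∧ (∀ x, 0 < ρ x) ∧ IsExhaustion ρ := by
  have : LocallyCompactSpace M := ChartedSpace.locallyCompactSpace (EuclideanSpace ℝ (Fin n)) M
  let K := CompactExhaustion.choice M
  obtain ⟨ρ, hρ⟩ := exists_contMDiffMap_forall_mem_convex_of_local_const (n := ⊤) (𝓡 n)
    (t := fun x : M => Set.Ioi (K.find x : ℝ)) (fun x => convex_Ioi _) fun x => by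
      obtain ⟨N, hN⟩ := K.exists_mem_nhds x
      refine ⟨N + 1, Filter.mem_of_superset hN fun y hy => ?_⟩
      have : (K.find y : ℝ) ≤ N := by exact_mod_cast K.mem_iff_find_le.1 hy
      exact lt_of_le_of_lt this (lt_add_one _)
  refine ⟨ρ, ρ.contMDiff.continuous, fun x => (Nat.cast_nonneg _).trans_lt (hρ x), fun a => ?_⟩
  refine (K.isCompact ⌈a⌉₊).closure_of_subset fun x hx => ?_
  rw [K.mem_iff_find_le]
  have h1 : (K.find x : ℝ) < a := lt_trans (hρ x) hx
  exact_mod_cast h1.le.trans (Nat.le_ceil a)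

lemma IsExhaustion.mono {X : Type*} [TopologicalSpace X] [T2Space X] {ρ φ : X → ℝ}
    (hρ : IsExhaustion ρ) (h : ∀ x, ρ x < φ x) : IsExhaustion φ := fun a =>
  (hρ a).closure_of_subset fun x hx => subset_closure ((h x).trans hx)

end laplace

end EllipticExhaustion

end

theorem theorem1p1 {n : ℕ} {M : Type*} [TopologicalSpace M] [T2Space M]
    [SecondCountableTopology M] [ChartedSpace (EuclideanSpace ℝ (Fin n)) M]
    [IsManifold (𝓡 n) ∞ M] [ConnectedSpace M] [NoncompactSpace M] :
    (∀ A : (M → ℝ) → (M → ℝ), EllipticExhaustion.IsLocallyUniformlyElliptic (n := n) A →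
      ∀ ρ : M → ℝ, Continuous ρ → (∀ x, 0 < ρ x) →
        ∃ φ : M → ℝ, ContMDiff (𝓡 n) 𝓘(ℝ, ℝ) ∞ φ ∧ (∀ x, ρ x < φ x) ∧ (∀ x, ρ x < A φ x)) ∧
    (∀ g : EllipticExhaustion.SmoothMetric n M,
      ∃ φ : M → ℝ, ContMDiff (𝓡 n) 𝓘(ℝ, ℝ) ∞ φ ∧
        EllipticExhaustion.IsStrictlySubharmonic g φ ∧ EllipticExhaustion.IsExhaustion φ) := by
  refine ⟨fun A hA ρ hρ hρ0 => hA.exists_contMDiff_lt hρ hρ0, fun g => ?_⟩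
  obtain ⟨ρ, hρ, hρ0, hρe⟩ := EllipticExhaustion.exists_continuous_pos_isExhaustion n M
  obtain ⟨φ, hφ, hφρ, hφA⟩ :=
    (EllipticExhaustion.isLocallyUniformlyElliptic_laplace g).exists_contMDiff_lt hρ hρ0
  have hφ2 := hφ.of_le EllipticExhaustion.two_le_infty
  refine ⟨φ, hφ, ⟨hφ2, fun e he x hx => ?_⟩, hρe.mono hφρ⟩
  rw [EllipticExhaustion.laplaceInChart_eq hφ2 he (IsManifold.chart_mem_maximalAtlas x) hx
    (mem_chart_source _ x)]
  exact (hρ0 x).trans (hφA x)
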